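/- Let $0<\alpha<1$ and $c>0$. There is a constant $\mathcal C>0$, depending only on $\alpha$ and $c$, such that the following holds. Let $A$ be a self-adjoint, positive-definite (possibly unbounded) linear operator with domain $D(A)$ in a real or complex Hilbert space $H$, let $\beta(t)=t^{\alpha-1}/\Gamma(\alpha)$ be the Abel kernel and $(\beta*\varphi)(t)=\int_0^t\beta(t-\zeta)\varphi(\zeta)\,d\zeta$. Let $f:[0,\infty)\to H$ be continuous and let $u:[0,\infty)\to D(A)$ be a solution of $$u_t+Au+(\beta*Au)(t)=f(t),\quad t>0,\qquad u(0)=u_0,$$ such that $u$ and $Au$ are continuously differentiable on $[0,\infty)$, $u$ is three times differentiable on $(0,\infty)$ and $Au$ is twice differentiable on $(0,\infty)$. Let $k>0$, $t_n=nk$, and let $U^n\in D(A)$, $n\ge 0$, be a solution of the Crank–Nicolson scheme $$\frac{U^n-U^{n-1}}{k}+A\,\frac{U^n+U^{n-1}}{2}+\frac{Q_n(AU)+Q_{n-1}(AU)}{2}=\frac{f(t_n)+f(t_{n-1})}{2},\quad n\ge1,\qquad U^0=u_0,$$ with the trapezoidal convolution quadrature $$Q_n(\varphi)=\kappa_{n,0}\,\varphi^0+k^\alpha\sum_{p=0}^n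 w_{n-p}\,\varphi^p,$$ where $$\sum_{m=0}^\infty w_mz^m=\Big(\frac{2(1-z)}{1+z}\Big)^{-\alpha},\qquad \kappa_{n,0}=(\beta*1)(t_n)-k^\alpha\sum_{p=0}^n w_p .$$ Then, with $\|v^n\|_A:=\big(\sum_{n=0}^\infty e^{-cn}\|v^n\|^2\big)^{1/2}$, $$\begin{aligned}\|U^n-u(t_n)\|_A\le \mathcal Ck\Big\{& e^{-\frac c2}\int_0^k\|u_{tt}(\zeta)\|\,d\zeta+\frac k2\sum_{n=2}^\infty e^{-\frac c2 n}\int_{t_{n-1}}^{t_n}\|u_{ttt}(\zeta)\|\,d\zeta\\&+\sum_{n=1}^\infty e^{-\frac c2 n}\Big(k^2t_n^{\alpha-1}\|Au_t(0)\|+k^{\alpha+1}\int_{t_{n-1}}^{t_n}\|Au_{tt}(\zeta)\|\,d\zeta+k^2\int_0^{t_{n-1}}(t_n-\zeta)^{\alpha-1}\|Au_{tt}(\zeta)\|\,d\zeta\Big)\Big\},\end{aligned}$$ where both sides are understood in $[0,\infty]$. -/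

import Mathlib

open MeasureTheory Set

namespace AbelCN

noncomputable section

/-- The Abel kernel `β(t) = t^(α-1) / Γ(α)`. -/
def abelKernel (α t : ℝ) : ℝ := t ^ (α - 1) / Real.Gamma α

/-- The convolution `(β * φ)(t) = ∫₀ᵗ β(t - ζ) φ(ζ) dζ`. -/
def conv {E : Type*} [NormedAddCommGroup E] [NormedSpace ℝ E]
    (β : ℝ → ℝ) (φ : ℝ → E) (t : ℝ) : E :=
  ∫ ζ in (0 : ℝ)..t, β (t - ζ) • φ ζ

/-- The weights `w_m`: the Taylor coefficients at `z = 0` of `(2(1-z)/(1+z))^(-α)`. -/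
def weight (α : ℝ) (m : ℕ) : ℝ :=
  iteratedDeriv m (fun z : ℝ => (2 * (1 - z) / (1 + z)) ^ (-α)) 0 / (m.factorial : ℝ)

/-- The starting weights `κ_{n,0} = (β * 1)(t_n) - k^α ∑_{p=0}^n w_p`, with `t_n = n k`. -/
def startWeight (α k : ℝ) (n : ℕ) : ℝ :=
  conv (abelKernel α) (fun _ => (1 : ℝ)) (n * k)
    - k ^ α * ∑ p ∈ Finset.range (n + 1), weight α p

/-- The quadrature `Q_n(φ) = κ_{n,0} φ⁰ + k^α ∑_{p=0}^n w_{n-p} φᵖ`. -/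
def quad {E : Type*} [NormedAddCommGroup E] [NormedSpace ℝ E]
    (α k : ℝ) (φ : ℕ → E) (n : ℕ) : E :=
  startWeight α k n • φ 0
    + k ^ α • ∑ p ∈ Finset.range (n + 1), weight α (n - p) • φ p

/-- The midpoint average `v^{n+1/2} = (v^{n+1} + v^n) / 2`. -/
def avg {E : Type*} [NormedAddCommGroup E] [NormedSpace ℝ E] (v : ℕ → E) (n : ℕ) : E :=
  (1 / 2 : ℝ) • (v (n + 1) + v n)

/-- The backward difference `δ_t v^{n+1} = (v^{n+1} - v^n) / k`. -/
def bdiff {E : Type*} [NormedAddCommGroup E] [NormedSpace ℝ E] (k : ℝ) (v : ℕ → E) (n : ℕ) : E :=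
  k⁻¹ • (v (n + 1) - v n)

section Operator

variable {𝕜 H : Type*} [RCLike 𝕜] [NormedAddCommGroup H] [InnerProductSpace 𝕜 H]

open Classical in
/-- The operator `A` as a function on all of `H`; the value `0` off the domain is a convention,
and is only used at points of the domain. -/
def app (A : H →ₗ.[𝕜] H) (x : H) : H := if h : x ∈ A.domain then A ⟨x, h⟩ else 0

/-- `A` is a (possibly unbounded) self-adjoint and positive definite operator. -/
structure IsPosDefSelfAdjoint [CompleteSpace H] (A : H →ₗ.[𝕜] H) : Prop where
  selfAdjoint : IsSelfAdjoint A
  pos : ∀ x : A.domain, (x : H) ≠ 0 → 0 < RCLike.re (inner 𝕜 (A x) (x : H))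

variable [NormedSpace ℝ H]

/-- `u` solves `u_t + A u + β * A u = f` for `t > 0`, `u(0) = u₀`, where `β` is the Abel kernel. -/
structure IsSolution (A : H →ₗ.[𝕜] H) (α : ℝ) (f : ℝ → H) (u₀ : H) (u : ℝ → H) : Prop where
  mem_domain : ∀ t, 0 ≤ t → u t ∈ A.domain
  continuousOn : ContinuousOn u (Ici 0)
  continuousOn_app : ContinuousOn (fun t => app A (u t)) (Ici 0)
  differentiableOn : DifferentiableOn ℝ u (Ioi 0)
  equation : ∀ t, 0 < t →
    deriv u t + app A (u t) + conv (abelKernel α) (fun ζ => app A (u ζ)) t = f t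
  initial : u 0 = u₀

/-- The derivatives `u_t` and `A u_t` exist and are continuous on `[0, ∞)`, and `u_tt`, `u_ttt` and
`A u_tt` exist on `(0, ∞)`. As a self-adjoint `A` is closed, the derivatives of `t ↦ A u(t)` that
exist here are `A u_t` and `A u_tt`; in particular `u_t` and `u_tt` take values in the domain. -/
structure IsRegular (A : H →ₗ.[𝕜] H) (u : ℝ → H) : Prop where
  u_one : ContDiffOn ℝ 1 u (Ici 0)
  u_two : DifferentiableOn ℝ (deriv u) (Ioi 0)
  u_three : DifferentiableOn ℝ (deriv (deriv u)) (Ioi 0)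
  Au_one : ContDiffOn ℝ 1 (fun t => app A (u t)) (Ici 0)
  Au_two : DifferentiableOn ℝ (deriv (fun t => app A (u t))) (Ioi 0)

/-- `U` solves the Crank-Nicolson scheme
`δ_t Uⁿ + A U^{n-1/2} + Q_{n-1/2}(A U) = f^{n-1/2}` for `n ≥ 1`, `U⁰ = u₀`, with time step `k`;
the equation is indexed by `n + 1`. -/
structure IsScheme (A : H →ₗ.[𝕜] H) (α k : ℝ) (f : ℝ → H) (u₀ : H) (U : ℕ → H) : Prop where
  mem_domain : ∀ n, U n ∈ A.domain
  step : ∀ n : ℕ,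
    bdiff k U n + avg (fun m => app A (U m)) n + avg (quad α k (fun m => app A (U m))) n
      = avg (fun m : ℕ => f (m * k)) n
  initial : U 0 = u₀

/-- The `n`-th summand
`e^{-cn/2} (k² t_n^{α-1} ‖A u_t(0)‖ + k^{α+1} ∫_{t_{n-1}}^{t_n} ‖A u_tt‖
  + k² ∫_0^{t_{n-1}} (t_n - ζ)^{α-1} ‖A u_tt(ζ)‖ dζ)`, for `n ≥ 1`. -/
def memoryTerm (A : H →ₗ.[𝕜] H) (α c k : ℝ) (u : ℝ → H) (n : ℕ) : ENNReal :=
  ENNReal.ofReal (Real.exp (-(c / 2) * n)) *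
    (ENNReal.ofReal (k ^ 2 * (n * k) ^ (α - 1)) * ‖app A (derivWithin u (Ici 0) 0)‖ₑ
      + ENNReal.ofReal (k ^ (α + 1)) *
          (∫⁻ ζ in Ioc (((n : ℝ) - 1) * k) (n * k), ‖app A (deriv (deriv u) ζ)‖ₑ)
      + ENNReal.ofReal (k ^ 2) *
          (∫⁻ ζ in Ioc 0 (((n : ℝ) - 1) * k),
            ENNReal.ofReal ((n * k - ζ) ^ (α - 1)) * ‖app A (deriv (deriv u) ζ)‖ₑ))

end Operator

/-- The weighted norm `‖vⁿ‖_A = (∑_{n ≥ 0} e^{-cn} ‖vⁿ‖²)^{1/2}`, with values in `[0, ∞]`. -/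
def weightedNorm {E : Type*} [NormedAddCommGroup E] (c : ℝ) (v : ℕ → E) : ENNReal :=
  (∑' n : ℕ, ENNReal.ofReal (Real.exp (-c * n)) * ‖v n‖ₑ ^ 2) ^ (1 / 2 : ℝ)

/-- The summand `e^{-cn/2} ∫_{t_{n-1}}^{t_n} ‖u_ttt‖`, for `n ≥ 2`. -/
def thirdDerivTerm {E : Type*} [NormedAddCommGroup E] [NormedSpace ℝ E]
    (c k : ℝ) (u : ℝ → E) (n : ℕ) : ENNReal :=
  ENNReal.ofReal (Real.exp (-(c / 2) * n)) *
    ∫⁻ ζ in Ioc (((n : ℝ) - 1) * k) (n * k), ‖deriv (deriv (deriv u)) ζ‖ₑ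

end

end AbelCN

open AbelCN

open MeasureTheory Set
open AbelCN

namespace AbelCN

/-! ### Laplace and Stieltjes representations of power functions -/

/-! The error e^n = U^n - u(t_n) solves the scheme with e^0 = 0 and a right-hand side made of the
trapezoidal truncation error of u_t and the error of the quadrature for β * Au. The proof is
stability plus consistency, and both rest on the Stieltjes formula Γ(1-α)Γ(α) s^(-α) = ∫₀^∞
r^(-α)/(s+r) dr. At s = 2(1-z)/(1+z) it writes w_m as a positive superposition of the coefficients
of 1/(s+r), which belong to the trapezoidal rule for y' + r y = φ (`weight_eq_integral`).

Stability: for each r that rule is of positive type, so the weights w_m are too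
(`sum_form_weight_nonneg`). Because e^0 = 0, averaging the quadrature gives the discrete convolution
of the midpoint averages of Ae. Testing with those averages yields ‖e^N‖ ≤ 2k ∑ ‖r_n‖
(`norm_le_of_scheme`), and a discrete Young inequality passes to the weighted norm
(`weightedNorm_le_of_norm_le_sum`).

Consistency: κ makes the rule exact on constants, so Taylor's formula expresses its error through a
Peano kernel (`quad_sub_conv_eq`). At an integer n the kernel is an integral of ((2-r)/(2+r))^n -
e^(-rn) against r^(-α-2), which is O(n^(α-1)); between integers one interpolates
(`exists_abs_peanoKernel_le`). The scaling k^(1+α) (t/k)^(α-1) = k² t^(α-1) gives the memory terms.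
The truncation error uses u_tt on the first step and u_ttt afterwards. Closedness of A identifies
the derivatives of Au with A u_t and A u_tt. -/

theorem integrableOn_and_integral_eq_of_lintegral {s : Set ℝ} (hs : MeasurableSet s) {f : ℝ → ℝ}
    {v : ℝ} (hv : 0 ≤ v) (hf : ∀ x ∈ s, 0 ≤ f x) (hm : Measurable f)
    (h : ∫⁻ x in s, ENNReal.ofReal (f x) = ENNReal.ofReal v) :
    IntegrableOn f s ∧ ∫ x in s, f x = v := by
  have h0 : 0 ≤ᵐ[volume.restrict s] f := by
    filter_upwards [ae_restrict_mem hs] with x hx using hf x hx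
  refine ⟨⟨hm.aestronglyMeasurable, ?_⟩, ?_⟩
  · rw [hasFiniteIntegral_iff_ofReal h0, h]
    exact ENNReal.ofReal_lt_top
  · rw [integral_eq_lintegral_of_nonneg_ae h0 hm.aestronglyMeasurable, h, ENNReal.toReal_ofReal hv]

theorem lintegral_eq_of_integral {s : Set ℝ} (hs : MeasurableSet s) {f : ℝ → ℝ}
    {v : ℝ} (hf : ∀ x ∈ s, 0 ≤ f x) (hi : IntegrableOn f s) (h : ∫ x in s, f x = v) :
    ∫⁻ x in s, ENNReal.ofReal (f x) = ENNReal.ofReal v := by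
  rw [← h, ofReal_integral_eq_lintegral_ofReal hi]
  filter_upwards [ae_restrict_mem hs] with x hx using hf x hx

theorem lintegral_rpow_mul_exp_neg {a r : ℝ} (ha : 0 < a) (hr : 0 < r) :
    ∫⁻ t in Ioi (0 : ℝ), ENNReal.ofReal (t ^ (a - 1) * Real.exp (-(r * t))) =
      ENNReal.ofReal (r ^ (-a) * Real.Gamma a) := by
  refine lintegral_eq_of_integral measurableSet_Ioi
    (fun t ht => mul_nonneg (Real.rpow_nonneg (mem_Ioi.1 ht).le _) (Real.exp_pos _).le) ?_ ?_
  · have := integrableOn_rpow_mul_exp_neg_mul_rpow (s := a - 1) (p := 1) (by linarith) one_pos hr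
    simpa [neg_mul] using this
  · rw [Real.integral_rpow_mul_exp_neg_mul_Ioi ha hr, one_div, Real.inv_rpow hr.le,
      Real.rpow_neg hr.le]

/-- The Laplace transform of `h`, integrated against `r ^ (-α)`. -/
theorem lintegral_rpow_mul_laplace {α : ℝ} (hα1 : α < 1) {h : ℝ → ENNReal} (hh : Measurable h) :
    ∫⁻ r in Ioi (0 : ℝ), ENNReal.ofReal (r ^ (-α)) *
        ∫⁻ t in Ioi (0 : ℝ), ENNReal.ofReal (Real.exp (-(r * t))) * h t =
      ENNReal.ofReal (Real.Gamma (1 - α)) *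
        ∫⁻ t in Ioi (0 : ℝ), ENNReal.ofReal (t ^ (α - 1)) * h t := by
  have h1 : ∀ r : ℝ, ENNReal.ofReal (r ^ (-α)) *
        ∫⁻ t in Ioi (0 : ℝ), ENNReal.ofReal (Real.exp (-(r * t))) * h t =
      ∫⁻ t in Ioi (0 : ℝ), ENNReal.ofReal (r ^ (-α)) *
        (ENNReal.ofReal (Real.exp (-(r * t))) * h t) := by
    intro r
    rw [lintegral_const_mul]
    fun_prop
  simp_rw [h1]
  rw [lintegral_lintegral_swap (by fun_prop), ← lintegral_const_mul _ (by fun_prop)]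
  refine setLIntegral_congr_fun measurableSet_Ioi fun t ht => ?_
  have ht' : 0 < t := ht
  have := lintegral_rpow_mul_exp_neg (a := 1 - α) (r := t) (by linarith) ht'
  have h2 : ∀ r ∈ Ioi (0 : ℝ), ENNReal.ofReal (r ^ (-α)) *
        (ENNReal.ofReal (Real.exp (-(r * t))) * h t) =
      ENNReal.ofReal (r ^ (1 - α - 1) * Real.exp (-(t * r))) * h t := by
    intro r hr
    rw [← mul_assoc, ← ENNReal.ofReal_mul (Real.rpow_nonneg (mem_Ioi.1 hr).le _), mul_comm t r]
    congr 4; ring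
  rw [setLIntegral_congr_fun measurableSet_Ioi h2, lintegral_mul_const _ (by fun_prop), this,
    ENNReal.ofReal_mul (Real.rpow_nonneg ht'.le _), neg_sub]
  ring

/-- Since 1/(s+r) is the Laplace transform of exp(-s t), Tonelli reduces the integral to two Gamma
integrals. -/
theorem integral_rpow_div_add {α : ℝ} (hα0 : 0 < α) (hα1 : α < 1) {s : ℝ} (hs : 0 < s) :
    IntegrableOn (fun r : ℝ => r ^ (-α) * (1 / (s + r))) (Ioi 0) ∧
      ∫ r in Ioi (0 : ℝ), r ^ (-α) * (1 / (s + r)) =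
        Real.Gamma (1 - α) * Real.Gamma α * s ^ (-α) := by
  have hG := Real.Gamma_pos_of_pos hα0
  have hG' := Real.Gamma_pos_of_pos (sub_pos.2 hα1)
  refine integrableOn_and_integral_eq_of_lintegral measurableSet_Ioi (by positivity)
    (fun r hr => ?_) (by fun_prop) ?_
  · have : 0 < r := hr
    positivity
  have key := lintegral_rpow_mul_laplace hα1
    (h := fun t => ENNReal.ofReal (Real.exp (-(s * t)))) (by fun_prop)
  have e1 : ∫⁻ t in Ioi (0 : ℝ), ENNReal.ofReal (t ^ (α - 1)) * ENNReal.ofReal (Real.exp (-(s * t)))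
      = ENNReal.ofReal (s ^ (-α) * Real.Gamma α) := by
    rw [← lintegral_rpow_mul_exp_neg hα0 hs]
    refine setLIntegral_congr_fun measurableSet_Ioi fun t ht => ?_
    exact (ENNReal.ofReal_mul (Real.rpow_nonneg (mem_Ioi.1 ht).le _)).symm
  rw [e1, ← ENNReal.ofReal_mul hG'.le] at key
  rw [mul_assoc, mul_comm (Real.Gamma α), ← key]
  refine setLIntegral_congr_fun measurableSet_Ioi fun r hr => ?_
  have hr' : 0 < r := hr
  rw [ENNReal.ofReal_mul (Real.rpow_nonneg hr'.le _)]
  congr 1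
  have := lintegral_rpow_mul_exp_neg (a := 1) (r := s + r) one_pos (by positivity)
  simp only [sub_self, Real.rpow_zero, one_mul, Real.Gamma_one, mul_one, Real.rpow_neg_one] at this
  rw [one_div, ← this]
  refine lintegral_congr fun t => ?_
  rw [← ENNReal.ofReal_mul (Real.exp_pos _).le, ← Real.exp_add]
  congr 2; ring

theorem integral_sub_mul_exp_neg {r : ℝ} (hr : 0 < r) {y : ℝ} :
    ∫ t in (0 : ℝ)..y, Real.exp (-(r * t)) * (y - t) =
      (r * y - 1 + Real.exp (-(r * y))) / r ^ 2 := by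
  have hd : ∀ t ∈ uIcc 0 y, HasDerivAt
      (fun t => -(y - t) * Real.exp (-(r * t)) / r + Real.exp (-(r * t)) / r ^ 2)
      (Real.exp (-(r * t)) * (y - t)) t := by
    intro t _
    have h1 : HasDerivAt (fun t => Real.exp (-(r * t))) (Real.exp (-(r * t)) * (-(r * 1))) t :=
      ((hasDerivAt_id t).const_mul r).neg.exp
    have h2 : HasDerivAt (fun t => -(y - t)) (-(0 - 1)) t :=
      ((hasDerivAt_const t y).sub (hasDerivAt_id t)).neg
    refine (((h2.mul h1).div_const r).add (h1.div_const (r ^ 2))).congr_deriv ?_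
    field_simp
    ring
  rw [intervalIntegral.integral_eq_sub_of_hasDerivAt hd
    (Continuous.intervalIntegrable (by fun_prop) _ _)]
  simp
  field_simp
  ring

theorem integral_rpow_mul_sub {α : ℝ} (hα0 : 0 < α) {y : ℝ} (hy : 0 ≤ y) :
    IntegrableOn (fun t : ℝ => t ^ (α - 1) * (y - t)) (Ioc 0 y) ∧
      ∫ t in Ioc 0 y, t ^ (α - 1) * (y - t) = y ^ (1 + α) / (α * (1 + α)) := by
  have hi : IntervalIntegrable (fun t : ℝ => t ^ (α - 1) * (y - t)) volume 0 y :=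
    (intervalIntegral.intervalIntegrable_rpow' (by linarith)).mul_continuousOn (by fun_prop)
  refine ⟨(intervalIntegrable_iff_integrableOn_Ioc_of_le hy).1 hi, ?_⟩
  rw [← intervalIntegral.integral_of_le hy]
  have hd : ∀ t ∈ Ioo 0 y, HasDerivAt
      (fun t : ℝ => y * t ^ α / α - t ^ (1 + α) / (1 + α)) (t ^ (α - 1) * (y - t)) t := by
    intro t ht
    have h1 := (Real.hasDerivAt_rpow_const (x := t) (p := α) (Or.inl ht.1.ne'))
    have h2 := (Real.hasDerivAt_rpow_const (x := t) (p := 1 + α) (Or.inl ht.1.ne'))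
    refine (((h1.const_mul y).div_const α).sub (h2.div_const (1 + α))).congr_deriv ?_
    have : t ^ (1 + α - 1) = t ^ (α - 1) * t := by
      rw [← Real.rpow_add_one ht.1.ne']; congr 1; ring
    rw [this]
    field_simp
  rw [intervalIntegral.integral_eq_sub_of_hasDerivAt_of_le hy ?_ hd hi]
  · rw [Real.zero_rpow hα0.ne', Real.zero_rpow (by positivity)]
    have : y ^ (1 + α) = y * y ^ α := by
      rw [Real.rpow_add_of_nonneg hy zero_le_one hα0.le, Real.rpow_one]
    rw [this]
    field_simp
    ring
  · exact ((continuousOn_const.mul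
      (Real.continuous_rpow_const hα0.le).continuousOn).div_const _).sub
      ((Real.continuous_rpow_const (by linarith)).continuousOn.div_const _)

/-- The integrand contains the Laplace transform of (y - t)₊. The lemma puts the exact convolution
of β with a linear function in the form of an integral against r^(-α) dr, so that it can be
subtracted from the quadrature under one integral sign. -/
theorem integral_rpow_mul_second_remainder {α : ℝ} (hα0 : 0 < α) (hα1 : α < 1) {y : ℝ}
    (hy : 0 ≤ y) :
    IntegrableOn (fun r : ℝ => r ^ (-α) * ((r * y - 1 + Real.exp (-(r * y))) / r ^ 2)) (Ioi 0) ∧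
      ∫ r in Ioi (0 : ℝ), r ^ (-α) * ((r * y - 1 + Real.exp (-(r * y))) / r ^ 2) =
        Real.Gamma (1 - α) * (y ^ (1 + α) / (α * (1 + α))) := by
  have hG' := Real.Gamma_pos_of_pos (sub_pos.2 hα1)
  refine integrableOn_and_integral_eq_of_lintegral measurableSet_Ioi (by positivity)
    (fun r hr => ?_) (by fun_prop) ?_
  · have : 0 < r := hr
    have := Real.add_one_le_exp (-(r * y))
    exact mul_nonneg (by positivity) (div_nonneg (by linarith) (by positivity))
  -- `ENNReal.ofReal (y - t)` vanishes for t > y, so it already encodes the positive part.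
  have supp : ∀ g : ℝ → ℝ, (∀ t, 0 ≤ t → 0 ≤ g t) →
      ∫⁻ t in Ioi (0 : ℝ), ENNReal.ofReal (g t) * ENNReal.ofReal (y - t) =
        ∫⁻ t in Ioc 0 y, ENNReal.ofReal (g t * (y - t)) := by
    intro g hg
    rw [← Ioc_union_Ioi_eq_Ioi hy, lintegral_union measurableSet_Ioi
      (Set.disjoint_left.2 fun x hx hx' => not_lt.2 hx.2 hx')]
    have z : ∫⁻ t in Ioi y, ENNReal.ofReal (g t) * ENNReal.ofReal (y - t) = 0 := by
      rw [setLIntegral_congr_fun (g := fun _ => 0) measurableSet_Ioi]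
      · simp
      · intro t ht
        simp [ENNReal.ofReal_of_nonpos (sub_nonpos.2 (mem_Ioi.1 ht).le)]
    rw [z, add_zero]
    exact setLIntegral_congr_fun measurableSet_Ioc
      fun t ht => (ENNReal.ofReal_mul (hg t ht.1.le)).symm
  have key := lintegral_rpow_mul_laplace hα1
    (h := fun t => ENNReal.ofReal (y - t)) (by fun_prop)
  obtain ⟨i1, i2⟩ := integral_rpow_mul_sub hα0 hy
  rw [supp (fun t => t ^ (α - 1)) (fun t ht => Real.rpow_nonneg ht _),
    lintegral_eq_of_integral measurableSet_Ioc (fun t ht => mul_nonneg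
      (Real.rpow_nonneg ht.1.le _) (sub_nonneg.2 ht.2)) i1 i2, ← ENNReal.ofReal_mul hG'.le] at key
  rw [← key]
  refine setLIntegral_congr_fun measurableSet_Ioi fun r hr => ?_
  have hr' : 0 < r := hr
  rw [ENNReal.ofReal_mul (Real.rpow_nonneg hr'.le _)]
  congr 1
  rw [supp (fun t => Real.exp (-(r * t))) (fun t _ => (Real.exp_pos _).le)]
  refine (lintegral_eq_of_integral measurableSet_Ioc (fun t ht => mul_nonneg
      (Real.exp_pos _).le (sub_nonneg.2 ht.2)) ?_ ?_).symm
  · exact (Continuous.integrableOn_Ioc (by fun_prop))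
  · rw [← intervalIntegral.integral_of_le hy, integral_sub_mul_exp_neg (mem_Ioi.1 hr)]

/-! ### The quadrature weights as superpositions of geometric sequences -/

/-- The Taylor coefficients at `z = 0` of `1 / (2 (1 - z) / (1 + z) + r)`. -/
noncomputable def resolventWeight (r : ℝ) : ℕ → ℝ
  | 0 => 1 / (2 + r)
  | m + 1 => 4 / (2 + r) ^ 2 * ((2 - r) / (2 + r)) ^ m

theorem abs_cayley_le_one {r : ℝ} (hr : 0 ≤ r) : |(2 - r) / (2 + r)| ≤ 1 := by
  rw [abs_le]
  constructor
  · rw [le_div_iff₀ (by positivity)]; linarith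
  · rw [div_le_iff₀ (by positivity)]; linarith

/-- The bound is uniform in m and integrable against r^(-α) by the Stieltjes formula at s = 2; it
justifies exchanging series and integral. -/
theorem abs_resolventWeight_le {r : ℝ} (hr : 0 ≤ r) (m : ℕ) :
    |resolventWeight r m| ≤ 2 * (1 / (2 + r)) := by
  cases m with
  | zero =>
    rw [resolventWeight, abs_of_nonneg (by positivity)]
    have : 0 ≤ 1 / (2 + r) := by positivity
    linarith
  | succ m =>
    rw [resolventWeight, abs_mul, abs_pow, abs_of_nonneg (by positivity)]
    calc 4 / (2 + r) ^ 2 * |(2 - r) / (2 + r)| ^ m ≤ 4 / (2 + r) ^ 2 * 1 := by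
          gcongr
          exact pow_le_one₀ (abs_nonneg _) (abs_cayley_le_one hr)
      _ ≤ 2 * (1 / (2 + r)) := by
          rw [mul_one, mul_one_div, div_le_div_iff₀ (by positivity) (by positivity)]
          nlinarith

theorem measurable_resolventWeight (m : ℕ) : Measurable fun r => resolventWeight r m := by
  cases m <;> simp only [resolventWeight] <;> fun_prop

theorem hasSum_of_eq {f g : ℕ → ℝ} {a : ℝ} (hf : HasSum f a) (h : ∀ m, f m = g m) : HasSum g a :=
  funext h ▸ hf

theorem hasSum_resolventWeight {r : ℝ} (hr : 0 < r) {z : ℝ} (hz : |z| < 1) :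
    HasSum (fun m => z ^ m * resolventWeight r m) (1 / (2 * (1 - z) / (1 + z) + r)) := by
  have hz' := abs_lt.1 hz
  have hq : |z * ((2 - r) / (2 + r))| < 1 := by
    rw [abs_mul]
    exact (mul_le_of_le_one_right (abs_nonneg _) (abs_cayley_le_one hr.le)).trans_lt hz
  have h1 := (hasSum_geometric_of_abs_lt_one hq).mul_left (z * (4 / (2 + r) ^ 2))
  have h2 : HasSum (fun m => z ^ (m + 1) * resolventWeight r (m + 1))
      (z * (4 / (2 + r) ^ 2) * (1 - z * ((2 - r) / (2 + r)))⁻¹) := by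
    refine hasSum_of_eq h1 fun m => ?_
    rw [resolventWeight, mul_pow]; ring
  have h3 := (hasSum_nat_add_iff (f := fun m => z ^ m * resolventWeight r m) 1).1 h2
  suffices hval : _ = 1 / (2 * (1 - z) / (1 + z) + r) from hval ▸ h3
  simp only [Finset.sum_range_one, pow_zero, one_mul, resolventWeight]
  have p1 : 2 + r ≠ 0 := by positivity
  have p2 : 1 + z ≠ 0 := by linarith
  have p3 : 2 + r - z * (2 - r) ≠ 0 := by
    have : z * (2 - r) < 2 + r := by nlinarith
    linarith
  have p4 : 1 - z * ((2 - r) / (2 + r)) ≠ 0 := by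
    rw [show 1 - z * ((2 - r) / (2 + r)) = (2 + r - z * (2 - r)) / (2 + r) by field_simp]
    exact div_ne_zero p3 p1
  have p5 : 2 * (1 - z) / (1 + z) + r ≠ 0 := by
    have : 0 ≤ 2 * (1 - z) / (1 + z) := div_nonneg (by linarith) (by linarith)
    positivity
  rw [eq_div_iff p5, show 1 - z * ((2 - r) / (2 + r)) = (2 + r - z * (2 - r)) / (2 + r) by
    field_simp]
  field_simp
  ring

theorem integrableOn_rpow_mul_resolventWeight {α : ℝ} (hα0 : 0 < α) (hα1 : α < 1) (m : ℕ) :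
    IntegrableOn (fun r : ℝ => r ^ (-α) * resolventWeight r m) (Ioi 0) := by
  refine Integrable.mono' ((integral_rpow_div_add hα0 hα1 two_pos).1.const_mul 2)
    (((by fun_prop : Measurable fun r : ℝ => r ^ (-α)).mul
      (measurable_resolventWeight m)).aestronglyMeasurable) ?_
  filter_upwards [ae_restrict_mem measurableSet_Ioi] with r hr
  have hr' : 0 < r := hr
  rw [Real.norm_eq_abs, abs_mul, abs_of_nonneg (by positivity)]
  calc r ^ (-α) * |resolventWeight r m| ≤ r ^ (-α) * (2 * (1 / (2 + r))) := by
        gcongr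
        exact abs_resolventWeight_le hr'.le m
    _ = _ := by ring

theorem hasSum_integral_resolventWeight {α : ℝ} (hα0 : 0 < α) (hα1 : α < 1) {z : ℝ}
    (hz : |z| < 1) :
    HasSum (fun m => z ^ m * ∫ r in Ioi (0 : ℝ), r ^ (-α) * resolventWeight r m)
      (Real.Gamma (1 - α) * Real.Gamma α * (2 * (1 - z) / (1 + z)) ^ (-α)) := by
  have hz' := abs_lt.1 hz
  have hs : 0 < 2 * (1 - z) / (1 + z) := div_pos (by linarith) (by linarith)
  obtain ⟨i2, -⟩ := integral_rpow_div_add hα0 hα1 two_pos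
  obtain ⟨-, e2⟩ := integral_rpow_div_add hα0 hα1 hs
  have hb : ∀ m : ℕ, ∫ r in Ioi (0 : ℝ), ‖z ^ m * (r ^ (-α) * resolventWeight r m)‖ ≤
      |z| ^ m * (2 * ∫ r in Ioi (0 : ℝ), r ^ (-α) * (1 / (2 + r))) := by
    intro m
    rw [← integral_const_mul, ← integral_const_mul]
    refine setIntegral_mono_on
      ((integrableOn_rpow_mul_resolventWeight hα0 hα1 m).const_mul _).norm
      ((i2.const_mul _).const_mul _) measurableSet_Ioi fun r hr => ?_
    have hr' : 0 < r := hr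
    rw [Real.norm_eq_abs, abs_mul, abs_mul, abs_pow, abs_of_nonneg (a := r ^ (-α)) (by positivity)]
    have := abs_resolventWeight_le hr'.le m
    calc |z| ^ m * (r ^ (-α) * |resolventWeight r m|)
        ≤ |z| ^ m * (r ^ (-α) * (2 * (1 / (2 + r)))) := by gcongr
      _ = _ := by ring
  have := hasSum_integral_of_summable_integral_norm (μ := volume.restrict (Ioi (0 : ℝ)))
    (F := fun (m : ℕ) r => z ^ m * (r ^ (-α) * resolventWeight r m))
    (fun m => (integrableOn_rpow_mul_resolventWeight hα0 hα1 m).const_mul _)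
    (Summable.of_nonneg_of_le (fun m => integral_nonneg fun r => norm_nonneg _) hb
      ((summable_geometric_of_lt_one (abs_nonneg z) hz).mul_right _))
  simp_rw [integral_const_mul] at this
  suffices hval : _ = Real.Gamma (1 - α) * Real.Gamma α * (2 * (1 - z) / (1 + z)) ^ (-α) from
    hval ▸ this
  rw [← e2]
  refine setIntegral_congr_fun measurableSet_Ioi fun r hr => ?_
  refine HasSum.tsum_eq
    (hasSum_of_eq ((hasSum_resolventWeight hr hz).mul_left (r ^ (-α))) fun m => ?_)
  ring

/-- The weights of the trapezoidal convolution quadrature as superpositions of the weights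
that belong to the kernels `exp (-r t)`. -/
theorem weight_eq_integral {α : ℝ} (hα0 : 0 < α) (hα1 : α < 1) (m : ℕ) :
    weight α m = (Real.Gamma (1 - α) * Real.Gamma α)⁻¹ *
      ∫ r in Ioi (0 : ℝ), r ^ (-α) * resolventWeight r m := by
  set I : ℕ → ℝ := fun m => (Real.Gamma (1 - α) * Real.Gamma α)⁻¹ *
      ∫ r in Ioi (0 : ℝ), r ^ (-α) * resolventWeight r m with hI
  have hG : Real.Gamma (1 - α) * Real.Gamma α ≠ 0 :=
    (mul_pos (Real.Gamma_pos_of_pos (sub_pos.2 hα1)) (Real.Gamma_pos_of_pos hα0)).ne'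
  have h1 : HasFPowerSeriesAt (fun z : ℝ => (2 * (1 - z) / (1 + z)) ^ (-α))
      (FormalMultilinearSeries.ofScalars ℝ I) 0 := by
    rw [hasFPowerSeriesAt_iff]
    filter_upwards [Metric.ball_mem_nhds (0 : ℝ) one_pos] with z hz
    have hz' : |z| < 1 := by simpa using hz
    have := (hasSum_integral_resolventWeight hα0 hα1 hz').mul_left
      (Real.Gamma (1 - α) * Real.Gamma α)⁻¹
    rw [← mul_assoc, inv_mul_cancel₀ hG, one_mul] at this
    simp only [FormalMultilinearSeries.coeff_ofScalars, zero_add, smul_eq_mul]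
    refine hasSum_of_eq this fun m => ?_
    simp only [hI]; ring
  -- Uniqueness of power series: the canonical expansion of an analytic function has exactly the
  -- coefficients used in `weight`.
  have h2 := h1.eq_formalMultilinearSeries h1.analyticAt.hasFPowerSeriesAt
  have := congrArg (fun p => FormalMultilinearSeries.coeff p m) h2
  simp only [FormalMultilinearSeries.coeff_ofScalars] at this
  exact this.symm

/-! ### Positivity of the quadrature -/

section Positivity

variable {V : Type*} [AddCommGroup V] [Module ℝ V]

/-- The generating function of the resolvent weights is (1+z)/((2+r) - (2-r)z); clearing the
denominator gives the trapezoidal rule with unit step for y' + r y = φ. -/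
theorem resolvent_recurrence {r : ℝ} (hr : 0 < r) (φ : ℕ → V) (n : ℕ) :
    (2 + r) • ∑ p ∈ Finset.range (n + 2), resolventWeight r (n + 1 - p) • φ p =
      (2 - r) • (∑ p ∈ Finset.range (n + 1), resolventWeight r (n - p) • φ p)
        + φ (n + 1) + φ n := by
  have p1 : 2 + r ≠ 0 := by positivity
  have h0 : (2 + r) * resolventWeight r 0 = 1 := by simp only [resolventWeight]; field_simp
  have h1 : (2 + r) * resolventWeight r 1 = (2 - r) * resolventWeight r 0 + 1 := by
    simp only [resolventWeight]; field_simp; ring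
  have h2 : ∀ m, (2 + r) * resolventWeight r (m + 2) = (2 - r) * resolventWeight r (m + 1) := by
    intro m
    simp only [resolventWeight, pow_succ]; field_simp
  rw [Finset.sum_range_succ, Finset.sum_range_succ, Finset.sum_range_succ _ n, Nat.sub_self,
    Nat.sub_self, smul_add, smul_add, smul_add, Finset.smul_sum, Finset.smul_sum]
  have e : ∑ p ∈ Finset.range n, (2 + r) • resolventWeight r (n + 1 - p) • φ p =
      ∑ p ∈ Finset.range n, (2 - r) • resolventWeight r (n - p) • φ p := by
    refine Finset.sum_congr rfl fun p hp => ?_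
    obtain ⟨j, rfl⟩ := Nat.exists_eq_add_of_lt (Finset.mem_range.1 hp)
    rw [show p + j + 1 + 1 - p = j + 2 by omega, show p + j + 1 - p = j + 1 by omega,
      smul_smul, smul_smul, h2]
  rw [e, show n + 1 - n = 1 by omega, smul_smul, smul_smul, smul_smul, h0, h1, add_smul, one_smul,
    one_smul]
  abel

/-- In terms of ψ = φ - r y the recurrence reads y_{n+1} - y_n = (ψ_{n+1} + ψ_n)/2, and y_0 = ψ_0/2;
the sum telescopes. -/
theorem resolvent_eq_sum {r : ℝ} (hr : 0 < r) (φ y ψ : ℕ → V)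
    (hy : ∀ n, y n = ∑ p ∈ Finset.range (n + 1), resolventWeight r (n - p) • φ p)
    (hψ : ∀ n, ψ n = φ n - r • y n) (n : ℕ) :
    y n = (1 / 2 : ℝ) • ψ n + ∑ j ∈ Finset.range n, ψ j := by
  induction n with
  | zero =>
    have h0 : (2 + r) • y 0 = φ 0 := by
      rw [hy, zero_add, Finset.sum_range_one, Nat.sub_self, resolventWeight, smul_smul]
      rw [mul_one_div_cancel (by positivity : 2 + r ≠ 0), one_smul]
    rw [hψ, ← h0, Finset.sum_range_zero]
    module
  | succ n ih =>
    have h := resolvent_recurrence hr φ n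
    rw [← hy n, ← hy (n + 1)] at h
    have h' : φ (n + 1) = (2 + r) • y (n + 1) - (2 - r) • y n - φ n := by rw [h]; abel
    have hs : ∑ j ∈ Finset.range n, ψ j = y n - (1 / 2 : ℝ) • ψ n := by
      rw [eq_sub_iff_add_eq, add_comm]; exact ih.symm
    rw [Finset.sum_range_succ, hs, hψ n, hψ (n + 1), h']
    module

variable (b : V →ₗ[ℝ] V →ₗ[ℝ] ℝ)

/-- By symmetry, the strict lower triangle plus half the diagonal is half of the full double sum. -/
theorem sum_form_summation (hsymm : ∀ x y, b x y = b y x) (ψ : ℕ → V) (N : ℕ) :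
    ∑ n ∈ Finset.range N, b (ψ n) ((1 / 2 : ℝ) • ψ n + ∑ j ∈ Finset.range n, ψ j) =
      1 / 2 * b (∑ n ∈ Finset.range N, ψ n) (∑ n ∈ Finset.range N, ψ n) := by
  induction N with
  | zero => simp
  | succ N ih =>
    rw [Finset.sum_range_succ, ih, Finset.sum_range_succ _ N]
    simp only [map_add, map_smul, LinearMap.add_apply, smul_eq_mul]
    rw [hsymm (∑ x ∈ Finset.range N, ψ x) (ψ N)]
    ring

/-- Writing φ = ψ + r y turns the sum into half the square of the total of ψ plus r times the sum of
the squares of the y_n. -/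
theorem sum_form_resolvent_nonneg (hsymm : ∀ x y, b x y = b y x) (hpos : ∀ x, 0 ≤ b x x)
    {r : ℝ} (hr : 0 < r) (φ : ℕ → V) (N : ℕ) :
    0 ≤ ∑ n ∈ Finset.range N,
      b (φ n) (∑ p ∈ Finset.range (n + 1), resolventWeight r (n - p) • φ p) := by
  set y : ℕ → V := fun n => ∑ p ∈ Finset.range (n + 1), resolventWeight r (n - p) • φ p
  set ψ : ℕ → V := fun n => φ n - r • y n with hψ
  have hy := resolvent_eq_sum hr φ y ψ (fun _ => rfl) (fun _ => rfl)
  have e : ∀ n, b (φ n) (y n) = b (ψ n) (y n) + r * b (y n) (y n) := by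
    intro n
    simp only [hψ, map_sub, LinearMap.sub_apply, map_smul, LinearMap.smul_apply, smul_eq_mul]
    ring
  have e2 : ∑ n ∈ Finset.range N, b (ψ n) (y n) =
      1 / 2 * b (∑ n ∈ Finset.range N, ψ n) (∑ n ∈ Finset.range N, ψ n) := by
    rw [← sum_form_summation b hsymm]
    exact Finset.sum_congr rfl fun n _ => by rw [← hy n]
  change 0 ≤ ∑ n ∈ Finset.range N, b (φ n) (y n)
  simp_rw [e]
  rw [Finset.sum_add_distrib, e2]
  exact add_nonneg (mul_nonneg (by norm_num) (hpos _))
    (Finset.sum_nonneg fun n _ => mul_nonneg hr.le (hpos _))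

/-- The trapezoidal convolution quadrature of the Abel kernel is of positive type. -/
theorem sum_form_weight_nonneg {α : ℝ} (hα0 : 0 < α) (hα1 : α < 1)
    (hsymm : ∀ x y, b x y = b y x) (hpos : ∀ x, 0 ≤ b x x) (φ : ℕ → V) (N : ℕ) :
    0 ≤ ∑ n ∈ Finset.range N,
      b (φ n) (∑ p ∈ Finset.range (n + 1), weight α (n - p) • φ p) := by
  have hG : 0 < Real.Gamma (1 - α) * Real.Gamma α :=
    (mul_pos (Real.Gamma_pos_of_pos (sub_pos.2 hα1)) (Real.Gamma_pos_of_pos hα0))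
  -- The expression is linear in the weights, so it is the integral of its resolvent versions
  -- against the positive density r^(-α).
  have e : ∑ n ∈ Finset.range N,
      b (φ n) (∑ p ∈ Finset.range (n + 1), weight α (n - p) • φ p) =
      (Real.Gamma (1 - α) * Real.Gamma α)⁻¹ * ∫ r in Ioi (0 : ℝ), r ^ (-α) *
        ∑ n ∈ Finset.range N,
          b (φ n) (∑ p ∈ Finset.range (n + 1), resolventWeight r (n - p) • φ p) := by
    have hi : ∀ n p : ℕ, Integrable (fun r : ℝ => r ^ (-α) * resolventWeight r (n - p) *
        b (φ n) (φ p)) (volume.restrict (Ioi 0)) := fun n p =>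
      (integrableOn_rpow_mul_resolventWeight hα0 hα1 (n - p)).mul_const _
    have e1 : ∀ r : ℝ, r ^ (-α) * ∑ n ∈ Finset.range N,
          b (φ n) (∑ p ∈ Finset.range (n + 1), resolventWeight r (n - p) • φ p) =
        ∑ n ∈ Finset.range N, ∑ p ∈ Finset.range (n + 1),
          r ^ (-α) * resolventWeight r (n - p) * b (φ n) (φ p) := by
      intro r
      simp only [map_sum, map_smul, smul_eq_mul, Finset.mul_sum, mul_assoc]
    simp_rw [e1]
    rw [integral_finsetSum _ fun n _ => integrable_finsetSum _ fun p _ => hi n p, Finset.mul_sum]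
    refine Finset.sum_congr rfl fun n _ => ?_
    rw [integral_finsetSum _ fun p _ => hi n p, Finset.mul_sum, map_sum]
    refine Finset.sum_congr rfl fun p _ => ?_
    rw [integral_mul_const, map_smul, smul_eq_mul, weight_eq_integral hα0 hα1, mul_assoc]
  rw [e]
  refine mul_nonneg (inv_pos.2 hG).le (setIntegral_nonneg measurableSet_Ioi fun r hr => ?_)
  exact mul_nonneg (Real.rpow_nonneg (mem_Ioi.1 hr).le _)
    (sum_form_resolvent_nonneg b hsymm hpos hr φ N)

end Positivity

/-! ### The quadrature error for linear functions -/

theorem sum_resolventWeight {r : ℝ} (hr : 0 < r) (n : ℕ) :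
    ∑ q ∈ Finset.range (n + 1), resolventWeight r q =
      (r + ((2 - r) / (2 + r)) ^ (n + 1) - ((2 - r) / (2 + r)) ^ n) / r ^ 2 := by
  have p1 : 2 + r ≠ 0 := by positivity
  induction n with
  | zero => simp [resolventWeight]; field_simp; ring
  | succ n ih =>
    rw [Finset.sum_range_succ, ih, resolventWeight]
    simp only [pow_succ]
    generalize ((2 - r) / (2 + r)) ^ n = x
    field_simp
    ring

/-- Compare `integral_sub_mul_exp_neg` at y = n: the discrete value is the exact one with exp(-rn)
replaced by the n-th power of the Cayley factor. -/
theorem sum_resolventWeight_mul {r : ℝ} (hr : 0 < r) (n : ℕ) :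
    ∑ q ∈ Finset.range (n + 1), resolventWeight r q * ((n : ℝ) - q) =
      (r * n - 1 + ((2 - r) / (2 + r)) ^ n) / r ^ 2 := by
  induction n with
  | zero => simp
  | succ n ih =>
    have e : ∑ q ∈ Finset.range (n + 1), resolventWeight r q * (((n + 1 : ℕ) : ℝ) - q) =
        ∑ q ∈ Finset.range (n + 1), resolventWeight r q * ((n : ℝ) - q) +
          ∑ q ∈ Finset.range (n + 1), resolventWeight r q := by
      rw [← Finset.sum_add_distrib]
      exact Finset.sum_congr rfl fun q _ => by push_cast; ring
    rw [Finset.sum_range_succ, e, ih, sum_resolventWeight hr, sub_self, mul_zero, add_zero,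
      ← add_div]
    push_cast
    ring

theorem rpow_div_Gamma_eq_integral {α : ℝ} (hα0 : 0 < α) (hα1 : α < 1) {y : ℝ} (hy : 0 ≤ y) :
    y ^ (1 + α) / Real.Gamma (2 + α) = (Real.Gamma (1 - α) * Real.Gamma α)⁻¹ *
      ∫ r in Ioi (0 : ℝ), r ^ (-α) * ((r * y - 1 + Real.exp (-(r * y))) / r ^ 2) := by
  rw [(integral_rpow_mul_second_remainder hα0 hα1 hy).2]
  have h1 := (Real.Gamma_pos_of_pos (sub_pos.2 hα1)).ne'
  have h2 := (Real.Gamma_pos_of_pos hα0).ne'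
  rw [show 2 + α = (α + 1) + 1 by ring, Real.Gamma_add_one (by positivity),
    Real.Gamma_add_one hα0.ne', add_comm 1 α]
  field_simp

theorem sum_weight_mul_sub_eq_integral {α : ℝ} (hα0 : 0 < α) (hα1 : α < 1) (n : ℕ) :
    (∑ q ∈ Finset.range (n + 1), weight α q * ((n : ℝ) - q)) -
        (n : ℝ) ^ (1 + α) / Real.Gamma (2 + α) =
      (Real.Gamma (1 - α) * Real.Gamma α)⁻¹ * ∫ r in Ioi (0 : ℝ), r ^ (-α) *
        ((((2 - r) / (2 + r)) ^ n - Real.exp (-(r * n))) / r ^ 2) := by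
  have hi : ∀ q : ℕ, Integrable (fun r : ℝ => r ^ (-α) * resolventWeight r q * ((n : ℝ) - q))
      (volume.restrict (Ioi 0)) := fun q =>
    (integrableOn_rpow_mul_resolventWeight hα0 hα1 q).mul_const _
  have e1 : ∑ q ∈ Finset.range (n + 1), weight α q * ((n : ℝ) - q) =
      (Real.Gamma (1 - α) * Real.Gamma α)⁻¹ * ∫ r in Ioi (0 : ℝ),
        ∑ q ∈ Finset.range (n + 1), r ^ (-α) * resolventWeight r q * ((n : ℝ) - q) := by
    rw [integral_finsetSum _ fun q _ => hi q, Finset.mul_sum]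
    refine Finset.sum_congr rfl fun q _ => ?_
    rw [integral_mul_const, weight_eq_integral hα0 hα1, mul_assoc]
  rw [e1, rpow_div_Gamma_eq_integral hα0 hα1 n.cast_nonneg, ← mul_sub, ← integral_sub
    (integrable_finsetSum _ fun q _ => hi q)
    (integral_rpow_mul_second_remainder hα0 hα1 n.cast_nonneg).1]
  congr 1
  refine setIntegral_congr_fun measurableSet_Ioi fun r hr => ?_
  have := sum_resolventWeight_mul hr n
  simp only [mul_assoc]
  rw [← Finset.mul_sum, this, ← mul_sub, ← sub_div]
  ring

/-! ### Comparison of the Cayley factor with the exponential -/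

theorem abs_cayley_sub_exp_le {r : ℝ} (hr : 0 ≤ r) (hr1 : r ≤ 1) :
    |(2 - r) / (2 + r) - Real.exp (-r)| ≤ r ^ 3 := by
  have h1 := Real.exp_bound (x := -r) (by rwa [abs_neg, abs_of_nonneg hr]) (n := 3) (by norm_num)
  have h2 : |(2 - r) / (2 + r) - (1 - r + r ^ 2 / 2)| ≤ r ^ 3 / 4 := by
    rw [show (2 - r) / (2 + r) - (1 - r + r ^ 2 / 2) = -(r ^ 3 / (2 * (2 + r))) by
      field_simp; ring, abs_neg, abs_of_nonneg (by positivity)]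
    gcongr
    linarith
  rw [abs_neg, abs_of_nonneg hr] at h1
  simp [Finset.sum_range_succ, Nat.factorial] at h1
  rw [abs_le] at *
  have : 0 ≤ r ^ 3 := by positivity
  constructor <;> linarith [h1.1, h1.2, h2.1, h2.2]

theorem abs_pow_sub_pow_le_mul {a b M : ℝ} (ha : |a| ≤ M) (hb : |b| ≤ M) (n : ℕ) :
    |a ^ (n + 1) - b ^ (n + 1)| ≤ (n + 1) * |a - b| * M ^ n := by
  have hM : 0 ≤ M := (abs_nonneg a).trans ha
  induction n with
  | zero => simp
  | succ n ih =>
    rw [show a ^ (n + 1 + 1) - b ^ (n + 1 + 1) =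
      a * (a ^ (n + 1) - b ^ (n + 1)) + b ^ (n + 1) * (a - b) by ring]
    refine (abs_add_le _ _).trans ?_
    rw [abs_mul, abs_mul, abs_pow]
    have h1 : |a| * |a ^ (n + 1) - b ^ (n + 1)| ≤ M * ((n + 1) * |a - b| * M ^ n) := by gcongr
    have h2 : |b| ^ (n + 1) * |a - b| ≤ M ^ (n + 1) * |a - b| := by gcongr
    refine (add_le_add h1 h2).trans_eq ?_
    push_cast
    ring

/-- For r ≤ 1 both bases are at most exp(-2r/3), and they differ by at most r³. The factor exp(2/3)
pays for having n - 1 instead of n powers left after telescoping. -/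
theorem abs_cayley_pow_sub_exp_le {r : ℝ} (hr : 0 < r) (hr1 : r ≤ 1) {n : ℕ} (hn : 1 ≤ n) :
    |((2 - r) / (2 + r)) ^ n - Real.exp (-(r * n))| ≤
      Real.exp (2 / 3) * (n * r ^ 3) * Real.exp (-(2 / 3 * n * r)) := by
  obtain ⟨n, rfl⟩ := Nat.exists_eq_add_of_le' hn
  have h1 : |(2 - r) / (2 + r)| ≤ Real.exp (-(2 / 3 * r)) := by
    rw [abs_of_nonneg (div_nonneg (by linarith) (by linarith))]
    refine le_trans ?_ (Real.add_one_le_exp _)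
    rw [div_le_iff₀ (by positivity)]
    nlinarith
  have h2 : |Real.exp (-r)| ≤ Real.exp (-(2 / 3 * r)) := by
    rw [abs_of_pos (Real.exp_pos _)]
    gcongr
    linarith
  have h3 := abs_pow_sub_pow_le_mul h1 h2 n
  rw [← Real.exp_nat_mul, ← Real.exp_nat_mul] at h3
  have e1 : ((n + 1 : ℕ) : ℝ) * -r = -(r * ((n + 1 : ℕ) : ℝ)) := by ring
  rw [e1] at h3
  refine h3.trans ?_
  calc ((n : ℝ) + 1) * |(2 - r) / (2 + r) - Real.exp (-r)| * Real.exp (n * -(2 / 3 * r))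
      ≤ (n + 1) * r ^ 3 * Real.exp (2 / 3 + -(2 / 3 * ((n + 1 : ℕ) : ℝ) * r)) := by
        gcongr
        · exact abs_cayley_sub_exp_le hr.le hr1
        · push_cast; nlinarith
    _ = _ := by rw [Real.exp_add]; push_cast; ring

theorem exp_neg_le_rpow {x a : ℝ} (hx : 0 < x) (ha0 : 0 ≤ a) (ha1 : a ≤ 1) :
    Real.exp (-x) ≤ x ^ (a - 1) := by
  rcases le_total x 1 with h | h
  · exact (Real.exp_le_one_iff.2 (by linarith)).trans
      (Real.one_le_rpow_of_pos_of_le_one_of_nonpos hx h (by linarith))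
  · have h1 : Real.exp (-x) ≤ x ^ (-1 : ℝ) := by
      rw [Real.exp_neg, Real.rpow_neg_one]
      gcongr
      linarith [Real.add_one_le_exp x]
    exact h1.trans (Real.rpow_le_rpow_of_exponent_le h (by linarith))

/-- The Cayley factor tends to -1 as r grows, so its powers decay only like exp(-2n/(3r)). This is
traded for the power (2n/(3r))^(α-1), which keeps the decay in n that is needed. -/
theorem abs_cayley_pow_sub_exp_le_rpow {α : ℝ} (hα0 : 0 < α) (hα1 : α < 1) {r : ℝ} (hr1 : 1 ≤ r)
    {n : ℕ} (hn : 1 ≤ n) :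
    |((2 - r) / (2 + r)) ^ n - Real.exp (-(r * n))| ≤
      2 * (2 / 3 : ℝ) ^ (α - 1) * (n : ℝ) ^ (α - 1) * r ^ (1 - α) := by
  have hr : 0 < r := by linarith
  have hn' : (0 : ℝ) < n := by exact_mod_cast hn
  have h1 : |(2 - r) / (2 + r)| ≤ Real.exp (-(2 / 3 / r)) := by
    refine le_trans ?_ (Real.add_one_le_exp _)
    have h : |2 - r| ≤ r := by rw [abs_le]; constructor <;> linarith
    rw [abs_div, abs_of_pos (by positivity : 0 < 2 + r), div_le_iff₀ (by positivity),
      show (-(2 / 3 / r) + 1) * (2 + r) = (r + 4 / 3) - 4 / 3 / r by field_simp; ring]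
    have : 4 / 3 / r ≤ 4 / 3 := div_le_self (by norm_num) hr1
    linarith
  have e0 : Real.exp (-(2 / 3 * n / r)) ≤
      (2 / 3 : ℝ) ^ (α - 1) * (n : ℝ) ^ (α - 1) * r ^ (1 - α) := by
    refine (exp_neg_le_rpow (by positivity) hα0.le hα1.le).trans_eq ?_
    rw [Real.div_rpow (by positivity) hr.le, Real.mul_rpow (by positivity) hn'.le,
      div_eq_mul_inv, ← Real.rpow_neg hr.le, neg_sub]
  have h2 : |(2 - r) / (2 + r)| ^ n ≤ Real.exp (-(2 / 3 * n / r)) := by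
    refine (pow_le_pow_left₀ (abs_nonneg _) h1 n).trans_eq ?_
    rw [← Real.exp_nat_mul]
    congr 1; ring
  have h3 : Real.exp (-(r * n)) ≤ Real.exp (-(2 / 3 * n / r)) := by
    gcongr
    rw [div_le_iff₀ hr]
    have : 1 ≤ r * r := by nlinarith
    nlinarith
  refine (abs_sub _ _).trans ?_
  rw [abs_pow, abs_of_pos (Real.exp_pos _)]
  linarith

/-- The integral is split at r = 1. Below, n ∫ r^(1-α) exp(-2nr/3) dr is of order n · n^(α-2);
above, n^(α-1) multiplies the integral of r^(-1-2α), finite because α > 0. -/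
theorem exists_abs_sum_weight_mul_sub_le {α : ℝ} (hα0 : 0 < α) (hα1 : α < 1) :
    ∃ C : ℝ, 0 ≤ C ∧ ∀ n : ℕ, 1 ≤ n →
      |(∑ q ∈ Finset.range (n + 1), weight α q * ((n : ℝ) - q)) -
        (n : ℝ) ^ (1 + α) / Real.Gamma (2 + α)| ≤ C * (n : ℝ) ^ (α - 1) := by
  have hG : 0 < Real.Gamma (1 - α) * Real.Gamma α :=
    (mul_pos (Real.Gamma_pos_of_pos (sub_pos.2 hα1)) (Real.Gamma_pos_of_pos hα0))
  have hG2 := Real.Gamma_pos_of_pos (by linarith : 0 < 2 - α)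
  set J := ∫ r in Ioi (1 : ℝ), r ^ (-1 - 2 * α)
  have hJ0 : 0 ≤ J := setIntegral_nonneg measurableSet_Ioi fun r hr =>
    Real.rpow_nonneg (zero_le_one.trans (mem_Ioi.1 hr).le) _
  have hJ : IntegrableOn (fun r : ℝ => r ^ (-1 - 2 * α)) (Ioi 1) :=
    integrableOn_Ioi_rpow_of_lt (by linarith) one_pos
  refine ⟨(Real.Gamma (1 - α) * Real.Gamma α)⁻¹ *
    (Real.exp (2 / 3) * ((2 / 3 : ℝ) ^ (α - 2) * Real.Gamma (2 - α)) +
      2 * (2 / 3 : ℝ) ^ (α - 1) * J), by positivity, fun n hn => ?_⟩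
  have hn' : (0 : ℝ) < n := by exact_mod_cast hn
  rw [sum_weight_mul_sub_eq_integral hα0 hα1, abs_mul, abs_of_pos (inv_pos.2 hG), mul_assoc]
  gcongr
  have hK := Real.integral_rpow_mul_exp_neg_mul_Ioi (a := 2 - α) (r := 2 / 3 * n) (by linarith)
    (by positivity)
  have hKi : IntegrableOn (fun r : ℝ => r ^ (2 - α - 1) * Real.exp (-(2 / 3 * n * r))) (Ioi 0) := by
    have := integrableOn_rpow_mul_exp_neg_mul_rpow (s := 2 - α - 1) (p := 1) (b := 2 / 3 * n)
      (by linarith) one_pos (by positivity)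
    simpa [neg_mul] using this
  have hL : IntegrableOn ((Ioi (1 : ℝ)).indicator fun r : ℝ => r ^ (-1 - 2 * α)) (Ioi 0) := by
    rw [IntegrableOn, integrable_indicator_iff measurableSet_Ioi, IntegrableOn,
      Measure.restrict_restrict measurableSet_Ioi,
      inter_eq_left.2 (Ioi_subset_Ioi zero_le_one)]
    exact hJ
  have hLJ : ∫ r in Ioi (0 : ℝ), (Ioi (1 : ℝ)).indicator (fun r : ℝ => r ^ (-1 - 2 * α)) r = J := by
    rw [integral_indicator measurableSet_Ioi, Measure.restrict_restrict measurableSet_Ioi,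
      inter_eq_left.2 (Ioi_subset_Ioi zero_le_one)]
  have hbd : ∀ᵐ r ∂volume.restrict (Ioi (0 : ℝ)),
      ‖r ^ (-α) * ((((2 - r) / (2 + r)) ^ n - Real.exp (-(r * n))) / r ^ 2)‖ ≤
        Real.exp (2 / 3) * n * (r ^ (2 - α - 1) * Real.exp (-(2 / 3 * n * r))) +
        2 * (2 / 3 : ℝ) ^ (α - 1) * (n : ℝ) ^ (α - 1) *
          (Ioi (1 : ℝ)).indicator (fun r : ℝ => r ^ (-1 - 2 * α)) r := by
    filter_upwards [ae_restrict_mem measurableSet_Ioi] with r hr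
    have hr' : 0 < r := hr
    rw [Real.norm_eq_abs, abs_mul, abs_of_nonneg (by positivity : 0 ≤ r ^ (-α)), abs_div,
      abs_of_pos (by positivity : 0 < r ^ 2)]
    rcases le_or_gt r 1 with h | h
    · rw [indicator_of_notMem (by simpa using h), mul_zero, add_zero]
      have := abs_cayley_pow_sub_exp_le hr' h hn
      calc _ ≤ r ^ (-α) * (Real.exp (2 / 3) * (n * r ^ 3) * Real.exp (-(2 / 3 * n * r)) / r ^ 2) :=
            by gcongr
        _ = _ := by
            rw [show 2 - α - 1 = -α + 1 by ring, Real.rpow_add_one hr'.ne']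
            field_simp
    · rw [indicator_of_mem (mem_Ioi.2 h)]
      have := abs_cayley_pow_sub_exp_le_rpow hα0 hα1 h.le hn
      have e : r ^ (-1 - 2 * α) = r ^ (-α) * (r ^ (1 - α) / r ^ 2) := by
        rw [← Real.rpow_natCast r 2, ← Real.rpow_sub hr', ← Real.rpow_add hr']
        congr 1; push_cast; ring
      refine le_add_of_nonneg_of_le (by positivity) ?_
      calc _ ≤ r ^ (-α) * ((2 * (2 / 3 : ℝ) ^ (α - 1) * (n : ℝ) ^ (α - 1) * r ^ (1 - α)) / r ^ 2) :=
            by gcongr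
        _ = _ := by rw [e]; ring
  have := norm_integral_le_of_norm_le ((hKi.const_mul _).add (hL.const_mul _)) hbd
  rw [Real.norm_eq_abs] at this
  refine this.trans_eq ?_
  simp only [Pi.add_apply]
  rw [integral_add (hKi.const_mul _) (hL.const_mul _), integral_const_mul, integral_const_mul,
    hLJ, hK, add_mul]
  congr 1
  · rw [one_div, Real.inv_rpow (by positivity), ← Real.rpow_neg (by positivity), neg_sub,
      Real.mul_rpow (by positivity) hn'.le, show α - 1 = (α - 2) + 1 by ring,
      Real.rpow_add_one hn'.ne']
    ring
  · ring

/-! ### The Peano kernel of the quadrature -/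

/-- The error of the quadrature with `k = 1` for the function `t ↦ (t - (n - y))₊` at time `n`. -/
noncomputable def peanoKernel (α : ℝ) (n : ℕ) (y : ℝ) : ℝ :=
  (∑ q ∈ Finset.range (n + 1), weight α q * max (y - q) 0) - y ^ (1 + α) / Real.Gamma (2 + α)

theorem sum_range_mul_posPart (w : ℕ → ℝ) {m n : ℕ} (hmn : m ≤ n) {y : ℝ} (hm : (m : ℝ) ≤ y)
    (hy : y ≤ m + 1) :
    ∑ q ∈ Finset.range (n + 1), w q * max (y - q) 0 =
      ∑ q ∈ Finset.range (m + 1), w q * (y - q) := by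
  rw [← Finset.sum_subset (Finset.range_mono (Nat.succ_le_succ hmn))]
  · refine Finset.sum_congr rfl fun q hq => ?_
    have : (q : ℝ) ≤ m := by exact_mod_cast Nat.lt_succ_iff.1 (Finset.mem_range.1 hq)
    rw [max_eq_left (by linarith)]
  · intro q _ hq
    have : (m : ℝ) + 1 ≤ q := by exact_mod_cast not_lt.1 (fun h => hq (Finset.mem_range.2 h))
    rw [max_eq_right (by linarith), mul_zero]

/-- Convexity puts the chord above the graph. The tangents at m and m+1 bound the gap by
(1+α)((m+1)^α - m^α), and Bernoulli's inequality bounds that increment by α m^(α-1). -/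
theorem rpow_chord_sub_le {α : ℝ} (hα0 : 0 < α) (hα1 : α < 1) {m y : ℝ} (hm : 1 ≤ m)
    (hmy : m ≤ y) (hy : y ≤ m + 1) :
    |(m + 1 - y) * m ^ (1 + α) + (y - m) * (m + 1) ^ (1 + α) - y ^ (1 + α)| ≤
      2 * m ^ (α - 1) := by
  have hm0 : 0 < m := by linarith
  have hy0 : 0 < y := by linarith
  have conv : ConvexOn ℝ (Ici 0) fun x : ℝ => x ^ (1 + α) := convexOn_rpow (by linarith)
  have tangent : ∀ x z : ℝ, 0 < x → 0 < z → x ^ (1 + α) + (1 + α) * x ^ α * (z - x) ≤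
      z ^ (1 + α) := by
    intro x z hx hz
    have hb := one_add_mul_self_le_rpow_one_add (s := z / x - 1) (p := 1 + α)
      (by have := div_pos hz hx; linarith) (by linarith)
    rw [add_sub_cancel, Real.div_rpow hz.le hx.le, le_div_iff₀ (by positivity)] at hb
    have e : x ^ (1 + α) = x * x ^ α := by rw [add_comm, Real.rpow_add_one hx.ne', mul_comm]
    refine le_trans (le_of_eq ?_) hb
    rw [e]
    field_simp
  have h1 : y ^ (1 + α) ≤ (m + 1 - y) * m ^ (1 + α) + (y - m) * (m + 1) ^ (1 + α) := by
    have := conv.2 (mem_Ici.2 hm0.le) (mem_Ici.2 (by linarith : (0 : ℝ) ≤ m + 1))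
      (by linarith : 0 ≤ m + 1 - y) (by linarith : 0 ≤ y - m) (by ring)
    simp only [smul_eq_mul] at this
    rwa [show (m + 1 - y) * m + (y - m) * (m + 1) = y by ring] at this
  have h2 := tangent m y hm0 hy0
  have h3 := tangent (m + 1) m (by linarith) hm0
  have h4 : (m + 1) ^ α ≤ m ^ α + α * m ^ (α - 1) := by
    have hb := rpow_one_add_le_one_add_mul_self (s := 1 / m) (p := α)
      (by have : 0 < 1 / m := by positivity
          linarith) hα0.le hα1.le
    rw [show m + 1 = m * (1 + 1 / m) by field_simp, Real.mul_rpow hm0.le (by positivity)]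
    calc m ^ α * (1 + 1 / m) ^ α ≤ m ^ α * (1 + α * (1 / m)) := by gcongr
      _ = _ := by rw [Real.rpow_sub_one hm0.ne']; ring
  have hp : 0 < m ^ (α - 1) := by positivity
  rw [abs_of_nonneg (by linarith)]
  have h5 : (y - m) * ((1 + α) * ((m + 1) ^ α - m ^ α)) ≤ 1 * ((1 + α) * (α * m ^ (α - 1))) := by
    have : m ^ α ≤ (m + 1) ^ α := Real.rpow_le_rpow hm0.le (by linarith) hα0.le
    exact mul_le_mul (by linarith) (by gcongr; linarith)
      (mul_nonneg (by linarith) (by linarith)) zero_le_one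
  have h6 : (1 + α) * (α * m ^ (α - 1)) ≤ 2 * m ^ (α - 1) := by
    rw [← mul_assoc]
    gcongr
    nlinarith
  have h7 := mul_le_mul_of_nonneg_left h3 (by linarith : 0 ≤ y - m)
  nlinarith

theorem exists_abs_peanoKernel_le {α : ℝ} (hα0 : 0 < α) (hα1 : α < 1) :
    ∃ C : ℝ, 0 < C ∧ (∀ (n : ℕ) (y : ℝ), 0 ≤ y → y ≤ 1 → |peanoKernel α n y| ≤ C) ∧
      ∀ (n : ℕ) (y : ℝ), 1 ≤ y → y ≤ n → |peanoKernel α n y| ≤ C * y ^ (α - 1) := by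
  obtain ⟨C, hC, hD⟩ := exists_abs_sum_weight_mul_sub_le hα0 hα1
  have hG := Real.Gamma_pos_of_pos (by linarith : 0 < 2 + α)
  -- The factor (1/2)^(α-1) converts m^(α-1) into y^(α-1), since m = ⌊y⌋ ≥ y/2 when y ≥ 1.
  set M := (C + 2 / Real.Gamma (2 + α)) * (1 / 2 : ℝ) ^ (α - 1) with hM
  have hM0 : 0 < M := by positivity
  refine ⟨|weight α 0| + 1 / Real.Gamma (2 + α) + M, by positivity, ?_, ?_⟩
  · intro n y hy0 hy1
    rw [peanoKernel, sum_range_mul_posPart (weight α) (Nat.zero_le n) (by simpa using hy0)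
      (by simpa using hy1), zero_add, Finset.sum_range_one, Nat.cast_zero, sub_zero]
    have h1 : |weight α 0 * y| ≤ |weight α 0| := by
      rw [abs_mul, abs_of_nonneg hy0]
      exact mul_le_of_le_one_right (abs_nonneg _) hy1
    have h2 : |y ^ (1 + α) / Real.Gamma (2 + α)| ≤ 1 / Real.Gamma (2 + α) := by
      rw [abs_of_nonneg (by positivity)]
      gcongr
      exact Real.rpow_le_one hy0 hy1 (by linarith)
    have := abs_sub (weight α 0 * y) (y ^ (1 + α) / Real.Gamma (2 + α))
    linarith
  · intro n y hy1 hyn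
    have hy0 : 0 < y := by linarith
    set m := ⌊y⌋₊ with hm
    have hmy : (m : ℝ) ≤ y := Nat.floor_le hy0.le
    have hym : y ≤ m + 1 := (Nat.lt_floor_add_one y).le
    have hm1 : 1 ≤ m := Nat.le_floor (by simpa using hy1)
    have hmn : m ≤ n := by exact_mod_cast hmy.trans hyn
    have hm1' : (1 : ℝ) ≤ m := by exact_mod_cast hm1
    set g : ℕ → ℝ := fun j => ∑ q ∈ Finset.range (j + 1), weight α q * ((j : ℝ) - q) with hg
    -- On [m, m+1] the sum is affine in y, hence interpolates its integer values; the new term q =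
    -- m+1 vanishes at the right end.
    have hgm : ∑ q ∈ Finset.range (m + 1), weight α q * (y - q) =
        (m + 1 - y) * g m + (y - m) * g (m + 1) := by
      simp only [hg]
      rw [Finset.sum_range_succ _ (m + 1), sub_self, mul_zero, add_zero, Finset.mul_sum,
        Finset.mul_sum, ← Finset.sum_add_distrib]
      exact Finset.sum_congr rfl fun q _ => by push_cast; ring
    rw [peanoKernel, sum_range_mul_posPart (weight α) hmn hmy hym, hgm]
    have d1 := hD m hm1
    have d2 := hD (m + 1) (by omega)
    have d3 := rpow_chord_sub_le hα0 hα1 hm1' hmy hym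
    have hmon : ((m + 1 : ℕ) : ℝ) ^ (α - 1) ≤ (m : ℝ) ^ (α - 1) :=
      Real.rpow_le_rpow_of_nonpos (by linarith) (by push_cast; linarith) (by linarith)
    have hmy2 : (m : ℝ) ^ (α - 1) ≤ (1 / 2 : ℝ) ^ (α - 1) * y ^ (α - 1) := by
      rw [← Real.mul_rpow (by norm_num) hy0.le]
      exact Real.rpow_le_rpow_of_nonpos (by positivity) (by linarith) (by linarith)
    have key : |(m + 1 - y) * g m + (y - m) * g (m + 1) - y ^ (1 + α) / Real.Gamma (2 + α)| ≤
        (C + 2 / Real.Gamma (2 + α)) * (m : ℝ) ^ (α - 1) := by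
      have e : (m + 1 - y) * g m + (y - m) * g (m + 1) - y ^ (1 + α) / Real.Gamma (2 + α) =
          (m + 1 - y) * (g m - (m : ℝ) ^ (1 + α) / Real.Gamma (2 + α)) +
          (y - m) * (g (m + 1) - ((m + 1 : ℕ) : ℝ) ^ (1 + α) / Real.Gamma (2 + α)) +
          ((m + 1 - y) * (m : ℝ) ^ (1 + α) + (y - m) * ((m : ℝ) + 1) ^ (1 + α) - y ^ (1 + α)) /
            Real.Gamma (2 + α) := by
        push_cast
        ring
      rw [e]
      refine (abs_add_le _ _).trans ((add_le_add (abs_add_le _ _) le_rfl).trans ?_)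
      rw [abs_mul, abs_mul, abs_div, abs_of_pos hG, abs_of_nonneg (by linarith : 0 ≤ m + 1 - y),
        abs_of_nonneg (by linarith : 0 ≤ y - m)]
      calc _ ≤ (m + 1 - y) * (C * (m : ℝ) ^ (α - 1)) + (y - m) * (C * (m : ℝ) ^ (α - 1)) +
            2 * (m : ℝ) ^ (α - 1) / Real.Gamma (2 + α) := by
            gcongr
            exact d2.trans (by gcongr)
        _ = _ := by ring
    refine key.trans ?_
    calc (C + 2 / Real.Gamma (2 + α)) * (m : ℝ) ^ (α - 1)
        ≤ (C + 2 / Real.Gamma (2 + α)) * ((1 / 2 : ℝ) ^ (α - 1) * y ^ (α - 1)) := by gcongr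
      _ = M * y ^ (α - 1) := by rw [hM]; ring
      _ ≤ _ := by
        gcongr
        have : 0 ≤ |weight α 0| + 1 / Real.Gamma (2 + α) := by positivity
        linarith

/-! ### The quadrature error -/

theorem hasDerivAt_rpow_div_Gamma {a : ℝ} (ha : 0 < a) {x : ℝ} (hx : 0 < x) :
    HasDerivAt (fun x : ℝ => x ^ a / Real.Gamma (1 + a)) (x ^ (a - 1) / Real.Gamma a) x := by
  refine ((Real.hasDerivAt_rpow_const (Or.inl hx.ne')).div_const _).congr_deriv ?_
  have := (Real.Gamma_pos_of_pos ha).ne'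
  rw [add_comm, Real.Gamma_add_one ha.ne']
  field_simp

theorem hasDerivAt_rpow_div_Gamma_sub {a : ℝ} (ha : 0 < a) {t x : ℝ} (hx : x < t) :
    HasDerivAt (fun x : ℝ => (t - x) ^ a / Real.Gamma (1 + a))
      (-((t - x) ^ (a - 1) / Real.Gamma a)) x := by
  have h := (hasDerivAt_rpow_div_Gamma ha (sub_pos.2 hx)).scomp x
    ((hasDerivAt_const x t).sub (hasDerivAt_id x))
  refine h.congr_deriv ?_
  simp

theorem intervalIntegrable_abelKernel_sub {α : ℝ} (hα0 : 0 < α) (t : ℝ) :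
    IntervalIntegrable (fun ζ => abelKernel α (t - ζ)) volume 0 t := by
  have := (intervalIntegral.intervalIntegrable_rpow' (a := 0) (b := t) (r := α - 1)
    (by linarith)).div_const (Real.Gamma α)
  simpa [abelKernel] using (this.comp_sub_left t).symm

section Regular

variable {E : Type*} [NormedAddCommGroup E] [NormedSpace ℝ E] [CompleteSpace E]
  {φ φ₁ φ₂ : ℝ → E}

theorem taylor_integral_remainder (hφ : ContinuousOn φ (Ici 0)) (hφ₁ : ContinuousOn φ₁ (Ici 0))
    (h₁ : ∀ t, 0 < t → HasDerivAt φ (φ₁ t) t) (h₂ : ∀ t, 0 < t → HasDerivAt φ₁ (φ₂ t) t)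
    {t : ℝ} (ht : 0 ≤ t) (hi : IntervalIntegrable φ₂ volume 0 t) :
    φ t = φ 0 + t • φ₁ 0 + ∫ ζ in (0 : ℝ)..t, (t - ζ) • φ₂ ζ := by
  have hsub : Icc 0 t ⊆ Ici 0 := Icc_subset_Ici_self
  have hF := intervalIntegral.integral_eq_sub_of_hasDerivAt_of_le ht
    (f := fun s => φ s + (t - s) • φ₁ s) (f' := fun s => (t - s) • φ₂ s)
    ((hφ.mono hsub).add ((by fun_prop : ContinuousOn (fun s => t - s) (Icc 0 t)).smul
      (hφ₁.mono hsub))) ?_ (hi.continuousOn_smul (by fun_prop))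
  · rw [hF]
    simp
  · intro s hs
    have hd : HasDerivAt (fun s => t - s) (-1) s := (hasDerivAt_id s).const_sub t
    refine ((h₁ s hs.1).add (hd.smul (h₂ s hs.1))).congr_deriv ?_
    module

/-- Two integrations by parts done at once, through an explicit primitive that is continuous up to
both endpoints. -/
theorem conv_abelKernel_eq {α : ℝ} (hα0 : 0 < α) (hφ : ContinuousOn φ (Ici 0))
    (hφ₁ : ContinuousOn φ₁ (Ici 0)) (h₁ : ∀ t, 0 < t → HasDerivAt φ (φ₁ t) t)
    (h₂ : ∀ t, 0 < t → HasDerivAt φ₁ (φ₂ t) t) {t : ℝ} (ht : 0 ≤ t)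
    (hi : IntervalIntegrable φ₂ volume 0 t) :
    conv (abelKernel α) φ t = (t ^ α / Real.Gamma (1 + α)) • φ 0 +
      (t ^ (1 + α) / Real.Gamma (2 + α)) • φ₁ 0 +
      ∫ ζ in (0 : ℝ)..t, ((t - ζ) ^ (1 + α) / Real.Gamma (2 + α)) • φ₂ ζ := by
  have hsub : Icc 0 t ⊆ Ici 0 := Icc_subset_Ici_self
  have c1 : Continuous fun s : ℝ => (t - s) ^ α / Real.Gamma (1 + α) :=
    ((Real.continuous_rpow_const hα0.le).comp (by fun_prop)).div_const _
  have c2 : Continuous fun s : ℝ => (t - s) ^ (1 + α) / Real.Gamma (2 + α) :=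
    ((Real.continuous_rpow_const (by linarith)).comp (by fun_prop)).div_const _
  have i1 : IntervalIntegrable (fun s => abelKernel α (t - s) • φ s) volume 0 t :=
    (intervalIntegrable_abelKernel_sub hα0 t).smul_continuousOn
      (by rw [uIcc_of_le ht]; exact hφ.mono hsub)
  have i2 : IntervalIntegrable (fun s => ((t - s) ^ (1 + α) / Real.Gamma (2 + α)) • φ₂ s)
      volume 0 t := hi.continuousOn_smul c2.continuousOn
  have hF := intervalIntegral.integral_eq_sub_of_hasDerivAt_of_le ht
    (f := fun s => ((t - s) ^ α / Real.Gamma (1 + α)) • φ s +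
      ((t - s) ^ (1 + α) / Real.Gamma (2 + α)) • φ₁ s)
    (f' := fun s => ((t - s) ^ (1 + α) / Real.Gamma (2 + α)) • φ₂ s - abelKernel α (t - s) • φ s)
    ((c1.continuousOn.smul (hφ.mono hsub)).add (c2.continuousOn.smul (hφ₁.mono hsub))) ?_
    (i2.sub i1)
  · rw [intervalIntegral.integral_sub i2 i1] at hF
    simp only [sub_self, Real.zero_rpow hα0.ne', Real.zero_rpow (by linarith : 1 + α ≠ 0), zero_div,
      zero_smul, sub_zero, add_zero, zero_sub] at hF
    rw [conv, eq_comm, ← sub_eq_zero, add_sub_assoc, hF, add_neg_cancel]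
  · intro s hs
    have d1 := (hasDerivAt_rpow_div_Gamma_sub hα0 hs.2).smul (h₁ s hs.1)
    have d2 := (hasDerivAt_rpow_div_Gamma_sub (by linarith : 0 < 1 + α) hs.2).smul (h₂ s hs.1)
    rw [← add_assoc, one_add_one_eq_two, add_sub_cancel_left] at d2
    refine (d1.add d2).congr_deriv ?_
    rw [abelKernel]
    module

theorem conv_abelKernel_one {α : ℝ} (hα0 : 0 < α) {t : ℝ} (ht : 0 ≤ t) :
    conv (abelKernel α) (fun _ => (1 : ℝ)) t = t ^ α / Real.Gamma (1 + α) := by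
  rw [conv_abelKernel_eq (φ₁ := fun _ => 0) (φ₂ := fun _ => 0) hα0 continuousOn_const
    continuousOn_const (fun t _ => hasDerivAt_const t 1) (fun t _ => hasDerivAt_const t 0) ht
    (by simp)]
  simp

/-- This brings the Taylor remainders at all nodes to one common interval, so that they can be
summed inside a single integral. -/
theorem integral_sub_smul_eq_posPart {E : Type*} [NormedAddCommGroup E] [NormedSpace ℝ E]
    {φ₂ : ℝ → E} {t T : ℝ} (ht : 0 ≤ t) (htT : t ≤ T)
    (hi : IntervalIntegrable φ₂ volume 0 T) :
    ∫ ζ in (0 : ℝ)..t, (t - ζ) • φ₂ ζ = ∫ ζ in (0 : ℝ)..T, max (t - ζ) 0 • φ₂ ζ := by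
  have hm : IntervalIntegrable (fun ζ => max (t - ζ) 0 • φ₂ ζ) volume 0 T :=
    hi.continuousOn_smul (by fun_prop)
  have s1 : uIcc 0 t ⊆ uIcc 0 T := by
    rw [uIcc_of_le ht, uIcc_of_le (ht.trans htT)]; exact Icc_subset_Icc_right htT
  have s2 : uIcc t T ⊆ uIcc 0 T := by
    rw [uIcc_of_le htT, uIcc_of_le (ht.trans htT)]; exact Icc_subset_Icc_left ht
  rw [← intervalIntegral.integral_add_adjacent_intervals (hm.mono_set s1) (hm.mono_set s2)]
  have z : ∫ ζ in t..T, max (t - ζ) 0 • φ₂ ζ = 0 := by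
    rw [intervalIntegral.integral_congr (g := fun _ => 0)]
    · simp
    · intro ζ hζ
      rw [uIcc_of_le htT] at hζ
      simp [max_eq_right (sub_nonpos.2 hζ.1)]
  rw [z, add_zero]
  refine intervalIntegral.integral_congr fun ζ hζ => ?_
  rw [uIcc_of_le ht] at hζ
  simp [max_eq_left (sub_nonneg.2 hζ.2)]

/-- Peano's argument: the error functional is linear and vanishes on constants by the choice of the
starting weights. It is evaluated on each term of the Taylor formula. -/
theorem quad_sub_conv_eq {α k : ℝ} (hα0 : 0 < α) (hk : 0 < k) (hφ : ContinuousOn φ (Ici 0))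
    (hφ₁ : ContinuousOn φ₁ (Ici 0)) (h₁ : ∀ t, 0 < t → HasDerivAt φ (φ₁ t) t)
    (h₂ : ∀ t, 0 < t → HasDerivAt φ₁ (φ₂ t) t) (n : ℕ)
    (hi : IntervalIntegrable φ₂ volume 0 (n * k)) :
    quad α k (fun m => φ (m * k)) n - conv (abelKernel α) φ (n * k) =
      (k ^ (1 + α) * peanoKernel α n n) • φ₁ 0 +
      ∫ ζ in (0 : ℝ)..(n * k), (k ^ (1 + α) * peanoKernel α n ((n * k - ζ) / k)) • φ₂ ζ := by
  have hn : (0 : ℝ) ≤ n := n.cast_nonneg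
  have hT : 0 ≤ n * k := by positivity
  have hkα : k ^ (1 + α) = k ^ α * k := by rw [add_comm, Real.rpow_add_one hk.ne']
  have point : ∀ q ∈ Finset.range (n + 1), φ (((n - q : ℕ) : ℝ) * k) =
      φ 0 + (k * max ((n : ℝ) - q) 0) • φ₁ 0 +
        ∫ ζ in (0 : ℝ)..(n * k), (k * max ((n * k - ζ) / k - q) 0) • φ₂ ζ := by
    intro q hq
    have hq' : q ≤ n := Nat.lt_succ_iff.1 (Finset.mem_range.1 hq)
    have hqr : (q : ℝ) ≤ n := by exact_mod_cast hq'
    have hq0 : (0 : ℝ) ≤ q := q.cast_nonneg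
    rw [Nat.cast_sub hq']
    have t0 : 0 ≤ ((n : ℝ) - q) * k := mul_nonneg (by linarith) hk.le
    have tT : ((n : ℝ) - q) * k ≤ n * k := by gcongr; linarith
    rw [taylor_integral_remainder hφ hφ₁ h₁ h₂ t0 (hi.mono_set (by
      rw [uIcc_of_le t0, uIcc_of_le hT]; exact Icc_subset_Icc_right tT)),
      integral_sub_smul_eq_posPart t0 tT hi, max_eq_left (by linarith : 0 ≤ (n : ℝ) - q),
      mul_comm k]
    congr 1
    refine intervalIntegral.integral_congr fun ζ _ => ?_
    congr 1
    rw [mul_max_of_nonneg _ _ hk.le, mul_zero]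
    congr 1
    field_simp
    ring
  have ii : ∀ q : ℕ, IntervalIntegrable
      (fun ζ => (weight α q * (k * max ((n * k - ζ) / k - q) 0)) • φ₂ ζ) volume 0 (n * k) :=
    fun q => hi.continuousOn_smul (by fun_prop)
  have hsum : ∑ p ∈ Finset.range (n + 1), weight α (n - p) • φ (p * k) =
      (∑ q ∈ Finset.range (n + 1), weight α q) • φ 0 +
      (k * ∑ q ∈ Finset.range (n + 1), weight α q * max ((n : ℝ) - q) 0) • φ₁ 0 +
      ∫ ζ in (0 : ℝ)..(n * k),
        (k * ∑ q ∈ Finset.range (n + 1), weight α q * max ((n * k - ζ) / k - q) 0) • φ₂ ζ := by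
    have e1 : ∑ p ∈ Finset.range (n + 1), weight α (n - p) • φ (p * k) =
        ∑ q ∈ Finset.range (n + 1), weight α q • φ (((n - q : ℕ) : ℝ) * k) := by
      rw [← Finset.sum_range_reflect]
      refine Finset.sum_congr rfl fun q hq => ?_
      have hq' : q ≤ n := Nat.lt_succ_iff.1 (Finset.mem_range.1 hq)
      rw [show n + 1 - 1 - q = n - q by omega, show n - (n - q) = q by omega]
    rw [e1, Finset.sum_congr rfl fun q hq => by rw [point q hq]]
    simp only [smul_add, Finset.sum_add_distrib, ← intervalIntegral.integral_smul, smul_smul]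
    rw [← Finset.sum_smul, ← Finset.sum_smul,
      ← intervalIntegral.integral_finsetSum fun q _ => ii q]
    congr 1
    · congr 2
      rw [Finset.mul_sum]
      exact Finset.sum_congr rfl fun q _ => by ring
    · refine intervalIntegral.integral_congr fun ζ _ => ?_
      rw [← Finset.sum_smul, Finset.mul_sum]
      congr 1
      exact Finset.sum_congr rfl fun q _ => by ring
  have j1 : IntervalIntegrable (fun ζ =>
      (k * ∑ q ∈ Finset.range (n + 1), weight α q * max ((n * k - ζ) / k - q) 0) • φ₂ ζ)
      volume 0 (n * k) := hi.continuousOn_smul (by fun_prop)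
  have c2 : Continuous fun s : ℝ => (n * k - s) ^ (1 + α) / Real.Gamma (2 + α) :=
    ((Real.continuous_rpow_const (by linarith)).comp (by fun_prop)).div_const _
  have j2 : IntervalIntegrable (fun ζ => ((n * k - ζ) ^ (1 + α) / Real.Gamma (2 + α)) • φ₂ ζ)
      volume 0 (n * k) := hi.continuousOn_smul c2.continuousOn
  have j3 : IntervalIntegrable (fun ζ => k ^ α •
      (k * ∑ q ∈ Finset.range (n + 1), weight α q * max ((n * k - ζ) / k - q) 0) • φ₂ ζ)
      volume 0 (n * k) := j1.smul _
  have hint : ∫ ζ in (0 : ℝ)..(n * k), (k ^ (1 + α) * peanoKernel α n ((n * k - ζ) / k)) • φ₂ ζ =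
      (k ^ α • ∫ ζ in (0 : ℝ)..(n * k),
        (k * ∑ q ∈ Finset.range (n + 1), weight α q * max ((n * k - ζ) / k - q) 0) • φ₂ ζ) -
      ∫ ζ in (0 : ℝ)..(n * k), ((n * k - ζ) ^ (1 + α) / Real.Gamma (2 + α)) • φ₂ ζ := by
    rw [← intervalIntegral.integral_smul, ← intervalIntegral.integral_sub j3 j2]
    refine intervalIntegral.integral_congr fun ζ hζ => ?_
    rw [uIcc_of_le hT] at hζ
    simp only [peanoKernel]
    rw [smul_smul, ← sub_smul, Real.div_rpow (sub_nonneg.2 hζ.2) hk.le, mul_sub, hkα]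
    congr 1
    field_simp
  have hpn : k ^ (1 + α) * peanoKernel α n n =
      k ^ α * (k * ∑ q ∈ Finset.range (n + 1), weight α q * max ((n : ℝ) - q) 0) -
        (n * k) ^ (1 + α) / Real.Gamma (2 + α) := by
    rw [peanoKernel, Real.mul_rpow hn hk.le, mul_sub, hkα]
    ring
  rw [hint, hpn, conv_abelKernel_eq hα0 hφ hφ₁ h₁ h₂ hT hi, quad, startWeight,
    conv_abelKernel_one hα0 hT, hsum]
  simp only [Nat.cast_zero, zero_mul]
  module

theorem rpow_mul_div_rpow {α k : ℝ} (hk : 0 < k) {x : ℝ} (hx : 0 ≤ x) :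
    k ^ (1 + α) * (x / k) ^ (α - 1) = k ^ 2 * x ^ (α - 1) := by
  have h : k ^ (1 + α) = k ^ 2 * k ^ (α - 1) := by
    rw [← Real.rpow_natCast k 2, ← Real.rpow_add hk]
    congr 1
    push_cast
    ring
  rw [Real.div_rpow hx hk.le, h]
  have : k ^ (α - 1) ≠ 0 := (Real.rpow_pos_of_pos hk _).ne'
  field_simp

theorem enorm_quad_sub_conv_le {α k C : ℝ} (hα0 : 0 < α) (hα1 : α < 1) (hk : 0 < k) (hC : 0 < C)
    (hC₁ : ∀ (n : ℕ) (y : ℝ), 0 ≤ y → y ≤ 1 → |peanoKernel α n y| ≤ C)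
    (hC₂ : ∀ (n : ℕ) (y : ℝ), 1 ≤ y → y ≤ n → |peanoKernel α n y| ≤ C * y ^ (α - 1))
    (hφ : ContinuousOn φ (Ici 0))
    (hφ₁ : ContinuousOn φ₁ (Ici 0)) (h₁ : ∀ t, 0 < t → HasDerivAt φ (φ₁ t) t)
    (h₂ : ∀ t, 0 < t → HasDerivAt φ₁ (φ₂ t) t)
    (hm : AEStronglyMeasurable φ₂ (volume.restrict (Ioi 0))) {n : ℕ} (hn : 1 ≤ n) :
    ‖quad α k (fun m => φ (m * k)) n - conv (abelKernel α) φ (n * k)‖ₑ ≤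
      ENNReal.ofReal C * (ENNReal.ofReal (k ^ 2 * (n * k) ^ (α - 1)) * ‖φ₁ 0‖ₑ
      + ENNReal.ofReal (k ^ (α + 1)) * (∫⁻ ζ in Ioc (((n : ℝ) - 1) * k) (n * k), ‖φ₂ ζ‖ₑ)
      + ENNReal.ofReal (k ^ 2) * (∫⁻ ζ in Ioc 0 (((n : ℝ) - 1) * k),
            ENNReal.ofReal ((n * k - ζ) ^ (α - 1)) * ‖φ₂ ζ‖ₑ)) := by
  have hn' : (1 : ℝ) ≤ n := by exact_mod_cast hn
  have a0 : 0 ≤ ((n : ℝ) - 1) * k := mul_nonneg (by linarith) hk.le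
  have a1 : ((n : ℝ) - 1) * k ≤ n * k := by gcongr; linarith
  have hT : 0 < n * k := by positivity
  set I₁ := ∫⁻ ζ in Ioc (((n : ℝ) - 1) * k) (n * k), ‖φ₂ ζ‖ₑ with hI₁
  set I₂ := ∫⁻ ζ in Ioc 0 (((n : ℝ) - 1) * k),
            ENNReal.ofReal ((n * k - ζ) ^ (α - 1)) * ‖φ₂ ζ‖ₑ with hI₂
  have hC' : ENNReal.ofReal C ≠ 0 := (ENNReal.ofReal_pos.2 hC).ne'
  by_cases t1 : I₁ = ⊤
  · rw [t1, ENNReal.mul_top (ENNReal.ofReal_pos.2 (by positivity)).ne', add_top, top_add,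
      ENNReal.mul_top hC']
    exact le_top
  by_cases t2 : I₂ = ⊤
  · rw [t2, ENNReal.mul_top (ENNReal.ofReal_pos.2 (by positivity)).ne', add_top,
      ENNReal.mul_top hC']
    exact le_top
  have hm' : ∀ {a b : ℝ}, 0 ≤ a → AEStronglyMeasurable φ₂ (volume.restrict (Ioc a b)) :=
    fun ha => hm.mono_measure (Measure.restrict_mono
      (fun x hx => mem_Ioi.2 (ha.trans_lt hx.1)) le_rfl)
  have split : Ioc 0 (n * k) = Ioc 0 (((n : ℝ) - 1) * k) ∪ Ioc (((n : ℝ) - 1) * k) (n * k) :=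
    (Ioc_union_Ioc_eq_Ioc a0 a1).symm
  have hdisj : Disjoint (Ioc 0 (((n : ℝ) - 1) * k)) (Ioc (((n : ℝ) - 1) * k) (n * k)) :=
    Set.disjoint_left.2 fun x hx hx' => not_lt.2 hx.2 hx'.1
  have i1 : IntegrableOn φ₂ (Ioc (((n : ℝ) - 1) * k) (n * k)) := ⟨hm' a0, lt_top_iff_ne_top.2 t1⟩
  have i2 : IntegrableOn φ₂ (Ioc 0 (((n : ℝ) - 1) * k)) := by
    refine ⟨hm' le_rfl, ?_⟩
    -- The singular weight is at least t_n^(α-1), so finiteness of the weighted integral gives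
    -- integrability of φ₂.
    have : ∫⁻ ζ in Ioc 0 (((n : ℝ) - 1) * k), ‖φ₂ ζ‖ₑ ≤
        ENNReal.ofReal ((n * k) ^ (1 - α)) * I₂ := by
      rw [hI₂, ← lintegral_const_mul' _ _ ENNReal.ofReal_ne_top]
      refine setLIntegral_mono' measurableSet_Ioc fun ζ hζ => ?_
      rw [← mul_assoc, ← ENNReal.ofReal_mul (by positivity)]
      refine le_mul_of_one_le_left zero_le ?_
      rw [ENNReal.one_le_ofReal]
      have hpos : 0 < n * k - ζ := by nlinarith [hζ.2]
      calc (1 : ℝ) = (n * k) ^ (1 - α) * (n * k) ^ (α - 1) := by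
            rw [← Real.rpow_add hT]; simp
        _ ≤ _ := by
            gcongr ?_ * ?_
            exact Real.rpow_le_rpow_of_nonpos hpos (by linarith [hζ.1]) (by linarith)
    exact this.trans_lt (ENNReal.mul_lt_top ENNReal.ofReal_lt_top (lt_top_iff_ne_top.2 t2))
  have hi : IntervalIntegrable φ₂ volume 0 (n * k) := by
    rw [intervalIntegrable_iff_integrableOn_Ioc_of_le hT.le, split]
    exact i2.union i1
  rw [quad_sub_conv_eq hα0 hk hφ hφ₁ h₁ h₂ n hi, add_assoc, mul_add]
  refine (enorm_add_le _ _).trans (add_le_add ?_ ?_)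
  · rw [enorm_smul, ← mul_assoc]
    gcongr ?_ * _
    rw [Real.enorm_eq_ofReal_abs, ← ENNReal.ofReal_mul hC.le]
    refine ENNReal.ofReal_le_ofReal ?_
    rw [abs_mul, abs_of_pos (by positivity)]
    have h := rpow_mul_div_rpow (α := α) hk hT.le
    rw [mul_div_cancel_right₀ _ hk.ne'] at h
    rw [← h]
    calc _ ≤ k ^ (1 + α) * (C * (n : ℝ) ^ (α - 1)) := by gcongr; exact hC₂ n n hn' le_rfl
      _ = _ := by ring
  -- For ζ ≤ t_{n-1} the argument (t_n - ζ)/k is at least 1 and the decaying bound applies; on the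
  -- last step it lies in [0, 1] and only the uniform bound is available.
  · rw [intervalIntegral.integral_of_le hT.le, split, add_comm (ENNReal.ofReal (k ^ (α + 1)) * I₁), mul_add]
    refine (enorm_integral_le_lintegral_enorm _).trans ?_
    rw [lintegral_union measurableSet_Ioc hdisj]
    refine add_le_add ?_ ?_
    · rw [hI₂, ← mul_assoc, ← ENNReal.ofReal_mul hC.le,
        ← lintegral_const_mul' _ _ ENNReal.ofReal_ne_top]
      refine setLIntegral_mono' measurableSet_Ioc fun ζ hζ => ?_
      have hpos : 0 < n * k - ζ := by nlinarith [hζ.2]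
      rw [enorm_smul, ← mul_assoc, ← ENNReal.ofReal_mul (by positivity)]
      gcongr ?_ * _
      rw [Real.enorm_eq_ofReal_abs]
      refine ENNReal.ofReal_le_ofReal ?_
      rw [abs_mul, abs_of_pos (by positivity), mul_assoc, ← rpow_mul_div_rpow hk hpos.le]
      calc _ ≤ k ^ (1 + α) * (C * ((n * k - ζ) / k) ^ (α - 1)) := by
            gcongr
            refine hC₂ n _ ?_ ?_
            · rw [le_div_iff₀ hk]; nlinarith [hζ.2]
            · rw [div_le_iff₀ hk]; linarith [hζ.1]
        _ = _ := by ring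
    · rw [hI₁, ← mul_assoc, ← ENNReal.ofReal_mul hC.le,
        ← lintegral_const_mul' _ _ ENNReal.ofReal_ne_top]
      refine setLIntegral_mono' measurableSet_Ioc fun ζ hζ => ?_
      rw [enorm_smul]
      gcongr ?_ * _
      rw [Real.enorm_eq_ofReal_abs]
      refine ENNReal.ofReal_le_ofReal ?_
      rw [abs_mul, abs_of_pos (by positivity), add_comm 1 α, mul_comm]
      gcongr
      refine hC₁ n _ (div_nonneg (sub_nonneg.2 hζ.2) hk.le) ?_
      rw [div_le_one hk]; nlinarith [hζ.1]

/-! ### The truncation error of the trapezoidal rule -/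

theorem enorm_sub_le_lintegral_deriv {a b : ℝ} (hφ : ContinuousOn φ (Icc a b))
    (h₁ : ∀ t ∈ Ioo a b, HasDerivAt φ (φ₁ t) t)
    (hm : AEStronglyMeasurable φ₁ (volume.restrict (Ioc a b))) {s t : ℝ} (has : a ≤ s)
    (hst : s ≤ t) (htb : t ≤ b) : ‖φ t - φ s‖ₑ ≤ ∫⁻ ζ in Ioc a b, ‖φ₁ ζ‖ₑ := by
  by_cases htop : ∫⁻ ζ in Ioc a b, ‖φ₁ ζ‖ₑ = ⊤
  · rw [htop]; exact le_top
  have hi : IntegrableOn φ₁ (Ioc a b) := ⟨hm, lt_top_iff_ne_top.2 htop⟩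
  have hsub : Ioc s t ⊆ Ioc a b := Ioc_subset_Ioc has htb
  rw [← intervalIntegral.integral_eq_sub_of_hasDerivAt_of_le hst
    (hφ.mono (Icc_subset_Icc has htb)) (fun x hx => h₁ x ⟨has.trans_lt hx.1, hx.2.trans_le htb⟩)
    ((intervalIntegrable_iff_integrableOn_Ioc_of_le hst).2 (hi.mono_set hsub)),
    intervalIntegral.integral_of_le hst]
  exact (enorm_integral_le_lintegral_enorm _).trans (lintegral_mono_set hsub)

theorem enorm_le_of_norm_le_toReal {E : Type*} [NormedAddCommGroup E] {x : E} {I : ENNReal}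
    {c : ℝ} (hc : 0 < c) (h : I ≠ ⊤ → ‖x‖ ≤ c * I.toReal) : ‖x‖ₑ ≤ ENNReal.ofReal c * I := by
  by_cases hI : I = ⊤
  · rw [hI, ENNReal.mul_top (ENNReal.ofReal_pos.2 hc).ne']; exact le_top
  · rw [← ENNReal.ofReal_toReal hI, ← ENNReal.ofReal_mul hc.le, ← ofReal_norm]
    exact ENNReal.ofReal_le_ofReal (h hI)

theorem norm_le_toReal_of_enorm_le {E : Type*} [NormedAddCommGroup E] {x : E} {I : ENNReal}
    (hI : I ≠ ⊤) (h : ‖x‖ₑ ≤ I) :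
    ‖x‖ ≤ I.toReal := by
  rw [← toReal_enorm]
  exact ENNReal.toReal_mono hI h

/-- For the first time step, where no third derivative is controlled near 0. After subtracting the
linear function with the averaged slope, the derivative is bounded by the oscillation of φ₁. -/
theorem enorm_trapezoid_le_second {k : ℝ} (hk : 0 < k) (hφ : ContinuousOn φ (Icc 0 k))
    (hφ₁ : ContinuousOn φ₁ (Icc 0 k))
    (h₁ : ∀ t ∈ Ico 0 k, HasDerivWithinAt φ (φ₁ t) (Ici t) t)
    (h₂ : ∀ t ∈ Ioo 0 k, HasDerivAt φ₁ (φ₂ t) t)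
    (hm : AEStronglyMeasurable φ₂ (volume.restrict (Ioc 0 k))) :
    ‖k⁻¹ • (φ k - φ 0) - (1 / 2 : ℝ) • (φ₁ k + φ₁ 0)‖ₑ ≤ ∫⁻ ζ in Ioc 0 k, ‖φ₂ ζ‖ₑ := by
  rw [← one_mul (∫⁻ ζ in Ioc 0 k, ‖φ₂ ζ‖ₑ), ← ENNReal.ofReal_one]
  refine enorm_le_of_norm_le_toReal one_pos fun htop => ?_
  set M := (∫⁻ ζ in Ioc 0 k, ‖φ₂ ζ‖ₑ).toReal
  have hM : ∀ {s t : ℝ}, 0 ≤ s → s ≤ t → t ≤ k → ‖φ₁ t - φ₁ s‖ ≤ M := fun hs hst ht =>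
    norm_le_toReal_of_enorm_le htop (enorm_sub_le_lintegral_deriv hφ₁ h₂ hm hs hst ht)
  have hd : ∀ t ∈ Ico 0 k, HasDerivWithinAt (fun t => φ t - t • (1 / 2 : ℝ) • (φ₁ k + φ₁ 0))
      (φ₁ t - (1 / 2 : ℝ) • (φ₁ k + φ₁ 0)) (Ici t) t := by
    intro t ht
    refine ((h₁ t ht).sub (((hasDerivAt_id t).smul_const _).hasDerivWithinAt)).congr_deriv ?_
    simp
  have hb := norm_image_sub_le_of_norm_deriv_right_le_segment
    (hφ.sub (by fun_prop)) hd (C := M) ?_ k (right_mem_Icc.2 hk.le)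
  · have e : k⁻¹ • (φ k - φ 0) - (1 / 2 : ℝ) • (φ₁ k + φ₁ 0) =
        k⁻¹ • ((φ k - k • (1 / 2 : ℝ) • (φ₁ k + φ₁ 0)) -
          (φ 0 - (0 : ℝ) • (1 / 2 : ℝ) • (φ₁ k + φ₁ 0))) := by
      rw [zero_smul, sub_zero, smul_sub, smul_sub, smul_sub, smul_smul k⁻¹ k,
        inv_mul_cancel₀ hk.ne', one_smul]
      abel
    rw [e, norm_smul, Real.norm_eq_abs, abs_of_pos (inv_pos.2 hk), one_mul, inv_mul_le_iff₀ hk]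
    simpa [mul_comm] using hb
  · intro t ht
    have e : φ₁ t - (1 / 2 : ℝ) • (φ₁ k + φ₁ 0) =
        (1 / 2 : ℝ) • (φ₁ t - φ₁ 0) - (1 / 2 : ℝ) • (φ₁ k - φ₁ t) := by module
    rw [e]
    refine (norm_sub_le _ _).trans ?_
    rw [norm_smul, norm_smul, Real.norm_of_nonneg (by norm_num)]
    have b1 := hM le_rfl ht.1 ht.2.le
    have b2 := hM ht.1 ht.2.le le_rfl
    linarith

/-- The mean value inequality is applied to φ(s) - (s-a)/2 · (φ₁(s) + φ₁(a)); its derivative is half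
the first-order Taylor error of φ₁ about s, which gains the factor b - a. -/
theorem enorm_trapezoid_le_third {φ₃ : ℝ → E} {a b : ℝ} (hab : a < b)
    (h₁ : ∀ t ∈ Icc a b, HasDerivAt φ (φ₁ t) t)
    (h₂ : ∀ t ∈ Icc a b, HasDerivAt φ₁ (φ₂ t) t)
    (h₃ : ∀ t ∈ Icc a b, HasDerivAt φ₂ (φ₃ t) t)
    (hm : AEStronglyMeasurable φ₃ (volume.restrict (Ioc a b))) :
    ‖(b - a)⁻¹ • (φ b - φ a) - (1 / 2 : ℝ) • (φ₁ b + φ₁ a)‖ₑ ≤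
      ENNReal.ofReal ((b - a) / 2) * ∫⁻ ζ in Ioc a b, ‖φ₃ ζ‖ₑ := by
  have hk : 0 < b - a := sub_pos.2 hab
  refine enorm_le_of_norm_le_toReal (by positivity) fun htop => ?_
  set M := (∫⁻ ζ in Ioc a b, ‖φ₃ ζ‖ₑ).toReal
  have hM0 : 0 ≤ M := ENNReal.toReal_nonneg
  have hM : ∀ {s t : ℝ}, a ≤ s → s ≤ t → t ≤ b → ‖φ₂ t - φ₂ s‖ ≤ M := fun hs hst ht =>
    norm_le_toReal_of_enorm_le htop (enorm_sub_le_lintegral_deriv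
      (fun x hx => (h₃ x hx).continuousAt.continuousWithinAt)
      (fun x hx => h₃ x (Ioo_subset_Icc_self hx)) hm hs hst ht)
  have first : ∀ s ∈ Icc a b, ‖φ₁ s - φ₁ a - (s - a) • φ₂ s‖ ≤ M * (s - a) := by
    intro s hs
    have hd : ∀ t ∈ Icc a s, HasDerivAt (fun t => φ₁ t - t • φ₂ s) (φ₂ t - φ₂ s) t := by
      intro t ht
      refine ((h₂ t ⟨ht.1, ht.2.trans hs.2⟩).sub ((hasDerivAt_id t).smul_const _)).congr_deriv ?_
      simp
    have hb := norm_image_sub_le_of_norm_deriv_right_le_segment (C := M)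
      (fun t ht => (hd t ht).continuousAt.continuousWithinAt)
      (fun t ht => (hd t (Ico_subset_Icc_self ht)).hasDerivWithinAt)
      (fun t ht => by rw [norm_sub_rev]; exact hM ht.1 ht.2.le hs.2) s (right_mem_Icc.2 hs.1)
    convert hb using 2
    module
  have hd : ∀ s ∈ Icc a b, HasDerivAt (fun s => φ s - ((s - a) / 2) • (φ₁ s + φ₁ a))
      ((1 / 2 : ℝ) • (φ₁ s - φ₁ a - (s - a) • φ₂ s)) s := by
    intro s hs
    have d : HasDerivAt (fun s => (s - a) / 2) (1 / 2) s :=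
      ((hasDerivAt_id s).sub_const a).div_const 2
    refine ((h₁ s hs).sub (d.smul ((h₂ s hs).add_const (φ₁ a)))).congr_deriv ?_
    module
  have hb := norm_image_sub_le_of_norm_deriv_right_le_segment (C := 1 / 2 * (M * (b - a)))
      (fun t ht => (hd t ht).continuousAt.continuousWithinAt)
      (fun t ht => (hd t (Ico_subset_Icc_self ht)).hasDerivWithinAt)
      (fun t ht => by
        rw [norm_smul, Real.norm_of_nonneg (by norm_num)]
        refine mul_le_mul_of_nonneg_left ((first t (Ico_subset_Icc_self ht)).trans ?_) (by norm_num)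
        gcongr
        exact ht.2.le) b (right_mem_Icc.2 hab.le)
  have e : (b - a)⁻¹ • (φ b - φ a) - (1 / 2 : ℝ) • (φ₁ b + φ₁ a) =
      (b - a)⁻¹ • ((φ b - ((b - a) / 2) • (φ₁ b + φ₁ a)) -
        (φ a - ((a - a) / 2) • (φ₁ a + φ₁ a))) := by
    rw [sub_self, zero_div, zero_smul, sub_zero, smul_sub, smul_sub, smul_sub, smul_smul,
      show (b - a)⁻¹ * ((b - a) / 2) = 1 / 2 by field_simp]
    abel
  rw [e, norm_smul, Real.norm_eq_abs, abs_of_pos (inv_pos.2 hk), inv_mul_le_iff₀ hk]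
  refine hb.trans_eq ?_
  ring

end Regular

/-! ### Stability of the scheme -/

/-- At an index j ≤ N where f is largest, every average is at most f j, and one factor f j cancels.
-/
theorem le_sum_of_sq_le_sum_mul_avg {f ρ : ℕ → ℝ} (hf : ∀ n, 0 ≤ f n) (hρ : ∀ n, 0 ≤ ρ n)
    (h : ∀ N, f N ^ 2 ≤ ∑ n ∈ Finset.range N, ρ n * ((f (n + 1) + f n) / 2)) (N : ℕ) :
    f N ≤ ∑ n ∈ Finset.range N, ρ n := by
  obtain ⟨j, hj, hmax⟩ := Finset.exists_max_image (Finset.range (N + 1)) f ⟨N, by simp⟩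
  have hjN : j ≤ N := Nat.lt_succ_iff.1 (Finset.mem_range.1 hj)
  have h1 : f j ^ 2 ≤ (∑ n ∈ Finset.range j, ρ n) * f j := by
    refine (h j).trans ?_
    rw [Finset.sum_mul]
    refine Finset.sum_le_sum fun n hn => mul_le_mul_of_nonneg_left ?_ (hρ n)
    have hnj := Finset.mem_range.1 hn
    have a1 := hmax (n + 1) (Finset.mem_range.2 (by omega))
    have a2 := hmax n (Finset.mem_range.2 (by omega))
    linarith
  have h2 : f j ≤ ∑ n ∈ Finset.range j, ρ n := by
    rcases (hf j).eq_or_lt with h0 | h0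
    · rw [← h0]; exact Finset.sum_nonneg fun n _ => hρ n
    · rw [pow_two] at h1; exact le_of_mul_le_mul_right h1 h0
  calc f N ≤ f j := hmax N (by simp)
    _ ≤ _ := h2
    _ ≤ _ := Finset.sum_le_sum_of_subset_of_nonneg (Finset.range_mono hjN) fun n _ _ => hρ n

theorem tsum_sum_range_geometric (q : ENNReal) (b : ℕ → ENNReal) :
    ∑' N : ℕ, ∑ n ∈ Finset.range N, q ^ (N - 1 - n) * b n = (1 - q)⁻¹ * ∑' n, b n := by
  have h1 : ∀ N : ℕ, ∑ n ∈ Finset.range N, q ^ (N - 1 - n) * b n =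
      ∑' n : ℕ, if n < N then q ^ (N - 1 - n) * b n else 0 := by
    intro N
    rw [tsum_eq_sum (s := Finset.range N)]
    · exact Finset.sum_congr rfl fun n hn => (if_pos (Finset.mem_range.1 hn)).symm
    · intro n hn
      rw [if_neg (fun h => hn (Finset.mem_range.2 h))]
  simp_rw [h1]
  rw [ENNReal.tsum_comm, ← ENNReal.tsum_mul_left]
  refine tsum_congr fun n => ?_
  rw [← ENNReal.summable.sum_add_tsum_nat_add' (k := n + 1), Finset.sum_eq_zero, zero_add,
    ← ENNReal.tsum_geometric, ← ENNReal.tsum_mul_right]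
  · refine tsum_congr fun j => ?_
    rw [if_pos (by omega), show j + (n + 1) - 1 - n = j by omega]
  · intro N hN
    have := Finset.mem_range.1 hN
    rw [if_neg (by omega)]

/-- With q = exp(-c/2), the sequence q^N ‖e_N‖ is dominated by a convolution of a geometric sequence
with b_n = q^(n+1) ‖r_n‖. Its ℓ² norm follows from its supremum, at most S = ∑ b_n, and its sum,
equal to S/(1-q). -/
theorem weightedNorm_le_of_norm_le_sum {E F : Type*} [NormedAddCommGroup E] [NormedAddCommGroup F]
    {c K : ℝ} (hc : 0 < c) (hK : 0 ≤ K) {e : ℕ → E} {r : ℕ → F}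
    (h : ∀ N, ‖e N‖ ≤ ∑ n ∈ Finset.range N, K * ‖r n‖) :
    weightedNorm c e ≤ ENNReal.ofReal (K / (1 - Real.exp (-(c / 2)))) *
      ∑' n : ℕ, ENNReal.ofReal (Real.exp (-(c / 2) * (n + 1 : ℕ))) * ‖r n‖ₑ := by
  set ρ := Real.exp (-(c / 2)) with hρ
  have hρ0 : 0 < ρ := Real.exp_pos _
  have hρ1 : ρ < 1 := by rw [hρ, Real.exp_lt_one_iff]; linarith
  have hpow : ∀ n : ℕ, ENNReal.ofReal (Real.exp (-(c / 2) * n)) = ENNReal.ofReal ρ ^ n := by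
    intro n
    rw [mul_comm, Real.exp_nat_mul, ENNReal.ofReal_pow hρ0.le]
  set q := ENNReal.ofReal ρ with hq
  set b : ℕ → ENNReal := fun n => q ^ (n + 1) * ‖r n‖ₑ with hb
  have hsum : ∑' n : ℕ, ENNReal.ofReal (Real.exp (-(c / 2) * (n + 1 : ℕ))) * ‖r n‖ₑ = ∑' n, b n :=
    tsum_congr fun n => by rw [hpow]
  rw [hsum]
  set S := ∑' n, b n with hS
  have hqi : (1 - q)⁻¹ = ENNReal.ofReal (1 / (1 - ρ)) := by
    rw [hq, ← ENNReal.ofReal_one, ← ENNReal.ofReal_sub _ hρ0.le, one_div,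
      ENNReal.ofReal_inv_of_pos (by linarith)]
  have hq1 : q ≤ 1 := by
    rw [hq, ENNReal.ofReal_le_one]; exact hρ1.le
  set G : ℕ → ENNReal := fun N => ∑ n ∈ Finset.range N, q ^ (N - 1 - n) * b n with hG
  have hGS : ∀ N, G N ≤ S := by
    intro N
    calc G N ≤ ∑ n ∈ Finset.range N, b n :=
          Finset.sum_le_sum fun n _ => mul_le_of_le_one_left zero_le (pow_le_one₀ zero_le hq1)
      _ ≤ S := ENNReal.sum_le_tsum _
  have hterm : ∀ N, q ^ N * ‖e N‖ₑ ≤ ENNReal.ofReal K * G N := by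
    intro N
    have h1 : ‖e N‖ₑ ≤ ∑ n ∈ Finset.range N, ENNReal.ofReal K * ‖r n‖ₑ := by
      rw [← ofReal_norm]
      refine (ENNReal.ofReal_le_ofReal (h N)).trans_eq ?_
      rw [ENNReal.ofReal_sum_of_nonneg fun n _ => by positivity]
      exact Finset.sum_congr rfl fun n _ => by rw [ENNReal.ofReal_mul hK, ofReal_norm]
    calc q ^ N * ‖e N‖ₑ ≤ q ^ N * ∑ n ∈ Finset.range N, ENNReal.ofReal K * ‖r n‖ₑ := by gcongr
      _ = ENNReal.ofReal K * G N := by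
        rw [hG, Finset.mul_sum, Finset.mul_sum]
        refine Finset.sum_congr rfl fun n hn => ?_
        have hn' := Finset.mem_range.1 hn
        have e : q ^ N = q ^ (N - 1 - n) * q ^ (n + 1) := by
          rw [← pow_add]; congr 1; omega
        rw [e, hb]; ring
  have hsq : ∑' n : ℕ, ENNReal.ofReal (Real.exp (-c * n)) * ‖e n‖ₑ ^ 2 ≤
      (ENNReal.ofReal (K / (1 - ρ)) * S) ^ 2 := by
    calc ∑' n : ℕ, ENNReal.ofReal (Real.exp (-c * n)) * ‖e n‖ₑ ^ 2
        = ∑' n : ℕ, (q ^ n * ‖e n‖ₑ) ^ 2 := by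
          refine tsum_congr fun n => ?_
          rw [mul_pow, ← hpow, ← ENNReal.ofReal_pow (Real.exp_pos _).le, ← Real.exp_nat_mul]
          congr 3; push_cast; ring
      _ ≤ ∑' n : ℕ, (ENNReal.ofReal K ^ 2 * S) * G n := by
          refine ENNReal.tsum_le_tsum fun n => ?_
          calc (q ^ n * ‖e n‖ₑ) ^ 2 ≤ (ENNReal.ofReal K * G n) ^ 2 :=
                pow_le_pow_left₀ zero_le (hterm n) 2
            _ = (ENNReal.ofReal K ^ 2 * G n) * G n := by ring
            _ ≤ _ := by gcongr; exact hGS n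
      _ = (ENNReal.ofReal K ^ 2 * S) * (ENNReal.ofReal (1 / (1 - ρ)) * S) := by
          rw [ENNReal.tsum_mul_left, hG, tsum_sum_range_geometric, hqi]
      _ ≤ (ENNReal.ofReal K ^ 2 * S) *
            ((ENNReal.ofReal (1 / (1 - ρ)) * ENNReal.ofReal (1 / (1 - ρ))) * S) := by
          gcongr
          refine le_mul_of_one_le_left zero_le ?_
          rw [ENNReal.one_le_ofReal, one_le_div (by linarith)]
          linarith
      _ = (ENNReal.ofReal (K / (1 - ρ)) * S) ^ 2 := by
          rw [div_eq_mul_one_div K, ENNReal.ofReal_mul hK]; ring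
  rw [weightedNorm]
  calc _ ≤ ((ENNReal.ofReal (K / (1 - ρ)) * S) ^ 2) ^ (1 / 2 : ℝ) := by gcongr
    _ = _ := by
      rw [← ENNReal.rpow_natCast, ← ENNReal.rpow_mul]
      norm_num

/-! ### The energy estimate -/

section Operator

variable {𝕜 H : Type*} [RCLike 𝕜] [NormedAddCommGroup H] [InnerProductSpace 𝕜 H]

theorem app_of_mem (A : H →ₗ.[𝕜] H) {x : H} (hx : x ∈ A.domain) : app A x = A ⟨x, hx⟩ :=
  dif_pos hx

theorem app_coe (A : H →ₗ.[𝕜] H) (x : A.domain) : app A x = A x := app_of_mem A x.2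

variable [NormedSpace ℝ H] [IsScalarTower ℝ 𝕜 H]

theorem map_real_smul_domain (A : H →ₗ.[𝕜] H) (r : ℝ) (x : A.domain) : A (r • x) = r • A x := by
  have h : r • x = (r : 𝕜) • x := Subtype.ext (RCLike.real_smul_eq_coe_smul (K := 𝕜) r (x : H))
  rw [h, LinearPMap.map_smul, RCLike.real_smul_eq_coe_smul (K := 𝕜) r (A x)]

theorem re_inner_real_smul_left (r : ℝ) (x y : H) :
    RCLike.re (inner 𝕜 (r • x) y) = r * RCLike.re (inner 𝕜 x y) := by
  rw [RCLike.real_smul_eq_coe_smul (K := 𝕜) r x, inner_smul_left, RCLike.conj_ofReal,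
    RCLike.re_ofReal_mul]

theorem re_inner_real_smul_right (r : ℝ) (x y : H) :
    RCLike.re (inner 𝕜 x (r • y)) = r * RCLike.re (inner 𝕜 x y) := by
  rw [RCLike.real_smul_eq_coe_smul (K := 𝕜) r y, inner_smul_right, RCLike.re_ofReal_mul]

/-- The quadratic form `Re ⟨A x, y⟩` on the domain of `A`. -/
noncomputable def energyForm (A : H →ₗ.[𝕜] H) : A.domain →ₗ[ℝ] A.domain →ₗ[ℝ] ℝ :=
  LinearMap.mk₂ ℝ (fun x y => RCLike.re (inner 𝕜 (A x) (y : H)))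
    (fun x x' y => by simp only [LinearPMap.map_add, inner_add_left, map_add])
    (fun r x y => by
      rw [map_real_smul_domain, re_inner_real_smul_left, smul_eq_mul])
    (fun x y y' => by simp only [Submodule.coe_add, inner_add_right, map_add])
    (fun r x y => by
      change RCLike.re (inner 𝕜 (A x) (r • (y : H))) = _
      rw [re_inner_real_smul_right, smul_eq_mul])

theorem energyForm_apply (A : H →ₗ.[𝕜] H) (x y : A.domain) :
    energyForm A x y = RCLike.re (inner 𝕜 (A x) (y : H)) := rfl

theorem energy_identity {k : ℝ} (x y : H) :
    RCLike.re (inner 𝕜 (k⁻¹ • (x - y)) ((1 / 2 : ℝ) • (x + y))) =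
      (2 * k)⁻¹ * (‖x‖ ^ 2 - ‖y‖ ^ 2) := by
  rw [re_inner_real_smul_left, re_inner_real_smul_right, inner_sub_left, inner_add_right,
    inner_add_right]
  simp only [map_sub, map_add, inner_self_eq_norm_sq]
  rw [inner_re_symm y x, mul_inv]
  ring

variable [CompleteSpace H]

theorem IsPosDefSelfAdjoint.energyForm_symm {A : H →ₗ.[𝕜] H} (hA : IsPosDefSelfAdjoint A)
    (x y : A.domain) : energyForm A x y = energyForm A y x := by
  have h := LinearPMap.adjoint_isFormalAdjoint hA.selfAdjoint.dense_domain
  rw [LinearPMap.isSelfAdjoint_def.1 hA.selfAdjoint] at h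
  rw [energyForm_apply, energyForm_apply, h x y, inner_re_symm]

theorem IsPosDefSelfAdjoint.energyForm_nonneg {A : H →ₗ.[𝕜] H} (hA : IsPosDefSelfAdjoint A)
    (x : A.domain) : 0 ≤ energyForm A x x := by
  rw [energyForm_apply]
  by_cases hx : (x : H) = 0
  · rw [hx, inner_zero_right, map_zero]
  · exact (hA.pos x hx).le

/-- Test the equation with the midpoint average: the difference quotient telescopes into squared
norms, the A-term is nonnegative at each step, and the memory term is nonnegative after summation.
-/
theorem sq_norm_le_of_scheme {A : H →ₗ.[𝕜] H} (hA : IsPosDefSelfAdjoint A) {α k : ℝ}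
    (hα0 : 0 < α) (hα1 : α < 1) (hk : 0 < k) {e : ℕ → A.domain} (he : e 0 = 0) {r : ℕ → H}
    (h : ∀ n, k⁻¹ • ((e (n + 1) : H) - e n) + A ((1 / 2 : ℝ) • (e (n + 1) + e n)) +
      k ^ α • A (∑ p ∈ Finset.range (n + 1),
        weight α (n - p) • ((1 / 2 : ℝ) • (e (p + 1) + e p))) = r n) (N : ℕ) :
    ‖(e N : H)‖ ^ 2 ≤ ∑ n ∈ Finset.range N,
      2 * k * ‖r n‖ * ((‖(e (n + 1) : H)‖ + ‖(e n : H)‖) / 2) := by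
  set ε : ℕ → A.domain := fun n => (1 / 2 : ℝ) • (e (n + 1) + e n) with hε
  have hεc : ∀ n, (ε n : H) = (1 / 2 : ℝ) • ((e (n + 1) : H) + e n) := fun n => rfl
  have hpos := sum_form_weight_nonneg (energyForm A) hα0 hα1 hA.energyForm_symm
    hA.energyForm_nonneg ε N
  have hstep : ∀ n, (2 * k)⁻¹ * (‖(e (n + 1) : H)‖ ^ 2 - ‖(e n : H)‖ ^ 2) +
      k ^ α * energyForm A (ε n) (∑ p ∈ Finset.range (n + 1), weight α (n - p) • ε p) ≤
        ‖r n‖ * ((‖(e (n + 1) : H)‖ + ‖(e n : H)‖) / 2) := by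
    intro n
    have h1 : RCLike.re (inner 𝕜 (r n) (ε n : H)) =
        (2 * k)⁻¹ * (‖(e (n + 1) : H)‖ ^ 2 - ‖(e n : H)‖ ^ 2) + energyForm A (ε n) (ε n) +
        k ^ α * energyForm A (ε n) (∑ p ∈ Finset.range (n + 1), weight α (n - p) • ε p) := by
      rw [← h n, inner_add_left, inner_add_left, map_add, map_add, re_inner_real_smul_left (k ^ α),
        hA.energyForm_symm (ε n) (∑ p ∈ Finset.range (n + 1), weight α (n - p) • ε p),
        energyForm_apply, energyForm_apply, hεc n, energy_identity]
    have h2 : RCLike.re (inner 𝕜 (r n) (ε n : H)) ≤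
        ‖r n‖ * ((‖(e (n + 1) : H)‖ + ‖(e n : H)‖) / 2) := by
      refine (re_inner_le_norm _ _).trans ?_
      gcongr
      rw [hεc, norm_smul, Real.norm_of_nonneg (by norm_num)]
      have := norm_add_le (e (n + 1) : H) (e n)
      linarith
    have h3 := hA.energyForm_nonneg (ε n)
    linarith
  have hsum := Finset.sum_le_sum fun n (_ : n ∈ Finset.range N) => hstep n
  rw [Finset.sum_add_distrib, ← Finset.mul_sum, ← Finset.mul_sum,
    Finset.sum_range_sub (fun n => ‖(e n : H)‖ ^ 2), he] at hsum
  simp only [Submodule.coe_zero, norm_zero, ne_eq, OfNat.ofNat_ne_zero, not_false_eq_true,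
    zero_pow, sub_zero] at hsum
  have h4 : (2 * k)⁻¹ * ‖(e N : H)‖ ^ 2 ≤
      ∑ n ∈ Finset.range N, ‖r n‖ * ((‖(e (n + 1) : H)‖ + ‖(e n : H)‖) / 2) := by
    have : 0 ≤ k ^ α * ∑ n ∈ Finset.range N,
      energyForm A (ε n) (∑ p ∈ Finset.range (n + 1), weight α (n - p) • ε p) := by positivity
    linarith
  rw [inv_mul_le_iff₀ (by positivity), Finset.mul_sum] at h4
  refine h4.trans_eq (Finset.sum_congr rfl fun n _ => by ring)

theorem norm_le_of_scheme {A : H →ₗ.[𝕜] H} (hA : IsPosDefSelfAdjoint A) {α k : ℝ}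
    (hα0 : 0 < α) (hα1 : α < 1) (hk : 0 < k) {e : ℕ → A.domain} (he : e 0 = 0) {r : ℕ → H}
    (h : ∀ n, k⁻¹ • ((e (n + 1) : H) - e n) + A ((1 / 2 : ℝ) • (e (n + 1) + e n)) +
      k ^ α • A (∑ p ∈ Finset.range (n + 1),
        weight α (n - p) • ((1 / 2 : ℝ) • (e (p + 1) + e p))) = r n) (N : ℕ) :
    ‖(e N : H)‖ ≤ ∑ n ∈ Finset.range N, 2 * k * ‖r n‖ :=
  le_sum_of_sq_le_sum_mul_avg (f := fun n => ‖(e n : H)‖) (fun _ => norm_nonneg _)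
    (fun _ => by positivity) (sq_norm_le_of_scheme hA hα0 hα1 hk he h) N

/-! ### Closedness -/

/-- A self-adjoint operator is closed, and the difference quotients of (x, Ax) lie in its graph.
One-sided derivatives are used so that t = 0 is covered. -/
theorem app_eq_of_hasDerivWithinAt {A : H →ₗ.[𝕜] H} (hA : IsPosDefSelfAdjoint A) {x : ℝ → H}
    {t : ℝ} {x' y' : H} (hx : ∀ s, t ≤ s → x s ∈ A.domain)
    (h₁ : HasDerivWithinAt x x' (Ici t) t)
    (h₂ : HasDerivWithinAt (fun s => app A (x s)) y' (Ici t) t) :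
    x' ∈ A.domain ∧ app A x' = y' := by
  have hcl : A.IsClosed := by
    have := LinearPMap.adjoint_isClosed hA.selfAdjoint.dense_domain
    rwa [LinearPMap.isSelfAdjoint_def.1 hA.selfAdjoint] at this
  rw [hasDerivWithinAt_iff_tendsto_slope, Ici_sdiff_left] at h₁ h₂
  have hlim := h₁.prodMk_nhds h₂
  have hmem : (x', y') ∈ (A.graph : Set (H × H)) := by
    refine IsClosed.mem_of_tendsto hcl hlim ?_
    filter_upwards [self_mem_nhdsWithin] with s hs
    have hs' : t ≤ s := (mem_Ioi.1 hs).le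
    rw [slope_def_module, slope_def_module, SetLike.mem_coe, LinearPMap.mem_graph_iff]
    refine ⟨(s - t)⁻¹ • (⟨x s, hx s hs'⟩ - ⟨x t, hx t le_rfl⟩), rfl, ?_⟩
    rw [map_real_smul_domain, LinearPMap.map_sub, app_of_mem A (hx s hs'),
      app_of_mem A (hx t le_rfl)]
  rw [SetLike.mem_coe, LinearPMap.mem_graph_iff] at hmem
  obtain ⟨z, hz, hz'⟩ := hmem
  simp only at hz hz'
  rw [← hz, ← hz']
  exact ⟨z.2, app_coe A z⟩

end Operator

/-! ### The error equation -/

section Derivatives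

variable {E : Type*} [NormedAddCommGroup E] [NormedSpace ℝ E] {φ : ℝ → E}

theorem hasDerivAt_derivWithin_Ici (h : ContDiffOn ℝ 1 φ (Ici 0)) {t : ℝ} (ht : 0 < t) :
    HasDerivAt φ (derivWithin φ (Ici 0) t) t :=
  ((h.differentiableOn one_ne_zero t ht.le).hasDerivWithinAt).hasDerivAt (Ici_mem_nhds ht)

theorem hasDerivWithinAt_Ici_derivWithin (h : ContDiffOn ℝ 1 φ (Ici 0)) {t : ℝ} (ht : 0 ≤ t) :
    HasDerivWithinAt φ (derivWithin φ (Ici 0) t) (Ici t) t :=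
  ((h.differentiableOn one_ne_zero t ht).hasDerivWithinAt).mono (Ici_subset_Ici.2 ht)

theorem hasDerivAt_derivWithin_deriv (h : ContDiffOn ℝ 1 φ (Ici 0))
    (h₂ : DifferentiableOn ℝ (deriv φ) (Ioi 0)) {t : ℝ} (ht : 0 < t) :
    HasDerivAt (derivWithin φ (Ici 0)) (deriv (deriv φ) t) t := by
  have h1 := ((h₂ t ht).differentiableAt (Ioi_mem_nhds ht)).hasDerivAt
  refine h1.congr_of_eventuallyEq ?_
  filter_upwards [Ioi_mem_nhds ht] with s hs
  exact (hasDerivAt_derivWithin_Ici h hs).deriv.symm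

theorem conv_abelKernel_zero (α : ℝ) (φ : ℝ → E) : conv (abelKernel α) φ 0 = 0 :=
  intervalIntegral.integral_same

theorem tendsto_conv_abelKernel_zero {α : ℝ} (hα0 : 0 < α) (hφ : ContinuousOn φ (Ici 0)) :
    Filter.Tendsto (conv (abelKernel α) φ) (nhdsWithin 0 (Ioi 0)) (nhds 0) := by
  obtain ⟨M, hM⟩ := isCompact_Icc.exists_bound_of_continuousOn
    (hφ.mono (Icc_subset_Ici_self : Icc (0 : ℝ) 1 ⊆ Ici 0))
  have hG := Real.Gamma_pos_of_pos hα0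
  have hlim : Filter.Tendsto (fun t : ℝ => t ^ α / Real.Gamma (1 + α) * M)
      (nhdsWithin 0 (Ioi 0)) (nhds 0) := by
    have : Continuous fun t : ℝ => t ^ α / Real.Gamma (1 + α) * M :=
      ((Real.continuous_rpow_const hα0.le).div_const _).mul_const _
    have h := this.tendsto 0
    rw [Real.zero_rpow hα0.ne', zero_div, zero_mul] at h
    exact h.mono_left nhdsWithin_le_nhds
  refine squeeze_zero_norm' ?_ hlim
  filter_upwards [Ioc_mem_nhdsGT (zero_lt_one' ℝ)] with t ht
  rw [← conv_abelKernel_one hα0 ht.1.le, conv, conv, ← intervalIntegral.integral_mul_const]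
  refine intervalIntegral.norm_integral_le_of_norm_le ht.1.le ?_ ?_
  · refine Filter.Eventually.of_forall fun ζ hζ => ?_
    have h0 : 0 ≤ abelKernel α (t - ζ) :=
      div_nonneg (Real.rpow_nonneg (sub_nonneg.2 hζ.2) _) hG.le
    rw [norm_smul, Real.norm_of_nonneg h0, smul_eq_mul, mul_one]
    exact mul_le_mul_of_nonneg_left (hM ζ ⟨hζ.1.le, hζ.2.trans ht.2⟩) h0
  · simpa using (intervalIntegrable_abelKernel_sub hα0 t).mul_const M

/-- At n = 0 the starting weight is -k^α w_0, cancelling the only term of the sum. -/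
theorem quad_zero {α k : ℝ} (y : ℕ → E) : quad α k y 0 = 0 := by
  rw [quad, startWeight, Nat.cast_zero, zero_mul, conv_abelKernel_zero]
  simp [smul_smul]

theorem quad_sub {α k : ℝ} (y z : ℕ → E) (n : ℕ) :
    quad α k (fun m => y m - z m) n = quad α k y n - quad α k z n := by
  simp only [quad, smul_sub, Finset.sum_sub_distrib]
  abel

/-- A vanishing initial value removes the starting weights and lets the index of Q_{n+1} be shifted;
the average then moves inside the convolution, the form required by the positivity argument. -/
theorem avg_quad_of_zero {α k : ℝ} {y : ℕ → E} (hy : y 0 = 0) (n : ℕ) :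
    avg (quad α k y) n = k ^ α • ∑ p ∈ Finset.range (n + 1),
      weight α (n - p) • ((1 / 2 : ℝ) • (y (p + 1) + y p)) := by
  rw [avg, quad, quad, hy, smul_zero, smul_zero, zero_add, zero_add, ← smul_add, smul_comm,
    Finset.sum_range_succ' _ (n + 1), hy, smul_zero, add_zero, ← Finset.sum_add_distrib,
    Finset.smul_sum]
  congr 1
  refine Finset.sum_congr rfl fun p _ => ?_
  rw [Nat.add_sub_add_right, ← smul_add, smul_comm]

end Derivatives

section Operator

variable {𝕜 H : Type*} [RCLike 𝕜] [NormedAddCommGroup H] [InnerProductSpace 𝕜 H]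
  [NormedSpace ℝ H]

/-- The first step of the scheme uses f(0), while the equation is given for t > 0 only; it extends
to t = 0 by continuity, the convolution tending to 0. -/
theorem IsSolution.equation_zero {A : H →ₗ.[𝕜] H} {α : ℝ} (hα0 : 0 < α) {f : ℝ → H}
    (hf : ContinuousOn f (Ici 0)) {u₀ : H} {u : ℝ → H} (hu : IsSolution A α f u₀ u)
    (hreg : IsRegular A u) {t : ℝ} (ht : 0 ≤ t) :
    f t = derivWithin u (Ici 0) t + app A (u t) +
      conv (abelKernel α) (fun ζ => app A (u ζ)) t := by
  have hpos : ∀ s, 0 < s → f s = derivWithin u (Ici 0) s + app A (u s) +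
      conv (abelKernel α) (fun ζ => app A (u ζ)) s := by
    intro s hs
    rw [← (hasDerivAt_derivWithin_Ici hreg.u_one hs).deriv]
    exact (hu.equation s hs).symm
  rcases ht.eq_or_lt with rfl | ht
  · have hsub : Ioi (0 : ℝ) ⊆ Ici 0 := Ioi_subset_Ici_self
    have l1 : Filter.Tendsto f (nhdsWithin 0 (Ioi 0)) (nhds (f 0)) :=
      (hf 0 self_mem_Ici).mono hsub
    have l2 : Filter.Tendsto (derivWithin u (Ici 0)) (nhdsWithin 0 (Ioi 0))
        (nhds (derivWithin u (Ici 0) 0)) :=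
      (hreg.u_one.continuousOn_derivWithin (uniqueDiffOn_Ici 0) le_rfl 0 self_mem_Ici).mono hsub
    have l3 : Filter.Tendsto (fun t => app A (u t)) (nhdsWithin 0 (Ioi 0)) (nhds (app A (u 0))) :=
      (hu.continuousOn_app 0 self_mem_Ici).mono hsub
    have l4 := tendsto_conv_abelKernel_zero hα0 hu.continuousOn_app
    rw [conv_abelKernel_zero]
    refine tendsto_nhds_unique (l1.congr' ?_) ((l2.add l3).add l4)
    filter_upwards [self_mem_nhdsWithin] with s hs using hpos s hs
  · exact hpos t ht

variable [IsScalarTower ℝ 𝕜 H] [CompleteSpace H]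

theorem app_derivWithin {A : H →ₗ.[𝕜] H} (hA : IsPosDefSelfAdjoint A) {u : ℝ → H}
    (hmem : ∀ t, 0 ≤ t → u t ∈ A.domain) (hreg : IsRegular A u) {t : ℝ} (ht : 0 ≤ t) :
    derivWithin u (Ici 0) t ∈ A.domain ∧
      app A (derivWithin u (Ici 0) t) = derivWithin (fun t => app A (u t)) (Ici 0) t :=
  app_eq_of_hasDerivWithinAt hA (fun s hs => hmem s (ht.trans hs))
    (hasDerivWithinAt_Ici_derivWithin hreg.u_one ht)
    (hasDerivWithinAt_Ici_derivWithin hreg.Au_one ht)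

theorem app_deriv_deriv {A : H →ₗ.[𝕜] H} (hA : IsPosDefSelfAdjoint A) {u : ℝ → H}
    (hmem : ∀ t, 0 ≤ t → u t ∈ A.domain) (hreg : IsRegular A u) {t : ℝ} (ht : 0 < t) :
    app A (deriv (deriv u) t) = deriv (deriv fun t => app A (u t)) t := by
  refine (app_eq_of_hasDerivWithinAt hA
    (fun s hs => (app_derivWithin hA hmem hreg (ht.le.trans hs)).1)
    (hasDerivAt_derivWithin_deriv hreg.u_one hreg.u_two ht).hasDerivWithinAt ?_).2
  refine (hasDerivAt_derivWithin_deriv hreg.Au_one hreg.Au_two ht).hasDerivWithinAt.congr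
    (fun s hs => (app_derivWithin hA hmem hreg (ht.le.trans hs)).2)
    (app_derivWithin hA hmem hreg ht.le).2

/-- The error `Uⁿ - u(t_n)` solves the scheme, with the consistency errors on the right. -/
theorem norm_scheme_error_le {A : H →ₗ.[𝕜] H} (hA : IsPosDefSelfAdjoint A) {α k : ℝ}
    (hα0 : 0 < α) (hα1 : α < 1) (hk : 0 < k) {f : ℝ → H} (hf : ContinuousOn f (Ici 0)) {u₀ : H}
    {u : ℝ → H} (hu : IsSolution A α f u₀ u) (hreg : IsRegular A u) {U : ℕ → H}
    (hU : IsScheme A α k f u₀ U) (N : ℕ) :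
    ‖U N - u (N * k)‖ ≤ ∑ n ∈ Finset.range N, 2 * k *
      ‖-(k⁻¹ • (u ((n + 1 : ℕ) * k) - u (n * k)) - (1 / 2 : ℝ) •
            (derivWithin u (Ici 0) ((n + 1 : ℕ) * k) + derivWithin u (Ici 0) (n * k))) -
        avg (fun n : ℕ => quad α k (fun m => app A (u (m * k))) n -
          conv (abelKernel α) (fun t => app A (u t)) (n * k)) n‖ := by
  have hum : ∀ n : ℕ, u (n * k) ∈ A.domain := fun n => hu.mem_domain _ (by positivity)
  set e : ℕ → A.domain := fun n => ⟨U n, hU.mem_domain n⟩ - ⟨u (n * k), hum n⟩ with he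
  have hec : ∀ n, (e n : H) = U n - u (n * k) := fun n => rfl
  have he0 : e 0 = 0 := by
    apply Subtype.ext
    rw [hec, hU.initial, Nat.cast_zero, zero_mul, hu.initial, sub_self]
    rfl
  have hAe : ∀ n, A (e n) = app A (U n) - app A (u (n * k)) := by
    intro n
    rw [he, LinearPMap.map_sub, app_of_mem A (hU.mem_domain n), app_of_mem A (hum n)]
  rw [← hec]
  refine norm_le_of_scheme hA hα0 hα1 hk he0 (fun n => ?_) N
  have hAε : ∀ n, A ((1 / 2 : ℝ) • (e (n + 1) + e n)) = (1 / 2 : ℝ) • (A (e (n + 1)) + A (e n)) :=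
    fun n => by rw [map_real_smul_domain, LinearPMap.map_add]
  have hAsum : A (∑ p ∈ Finset.range (n + 1),
        weight α (n - p) • ((1 / 2 : ℝ) • (e (p + 1) + e p))) =
      ∑ p ∈ Finset.range (n + 1), weight α (n - p) • ((1 / 2 : ℝ) • (A (e (p + 1)) + A (e p))) := by
    rw [← LinearPMap.toFun_eq_coe, map_sum]
    exact Finset.sum_congr rfl fun p _ => by
      rw [LinearPMap.toFun_eq_coe, map_real_smul_domain, hAε]
  have hA0 : A (e 0) = 0 := by rw [he0, LinearPMap.map_zero]
  have hquad := avg_quad_of_zero (α := α) (k := k) (y := fun n => A (e n)) hA0 n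
  simp only [hAe] at hquad
  rw [hAsum, hAε, hec, hec]
  simp only [hAe]
  rw [← hquad]
  have hf' : ∀ m : ℕ, f (m * k) = derivWithin u (Ici 0) (m * k) + app A (u (m * k)) +
      conv (abelKernel α) (fun ζ => app A (u ζ)) (m * k) := fun m =>
    hu.equation_zero hα0 hf hreg (by positivity)
  have hstep := hU.step n
  simp only [avg, bdiff, quad_sub] at hstep ⊢
  rw [hf', hf', ← sub_eq_zero] at hstep
  rw [← sub_eq_zero, ← hstep]
  module

end Operator

end AbelCN

/-! ### Assembly of the error estimate -/

open AbelCN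

theorem theorem3p11 (α c : ℝ) (hα0 : 0 < α) (hα1 : α < 1) (hc : 0 < c) :
    ∃ C : ℝ, 0 < C ∧
      ∀ (𝕜 H : Type*) [RCLike 𝕜] [NormedAddCommGroup H] [InnerProductSpace 𝕜 H]
        [NormedSpace ℝ H] [IsScalarTower ℝ 𝕜 H] [CompleteSpace H]
        (A : H →ₗ.[𝕜] H) (_hA : IsPosDefSelfAdjoint A)
        (f : ℝ → H) (_hf : ContinuousOn f (Ici 0)) (u₀ : H)
        (u : ℝ → H) (_hu : IsSolution A α f u₀ u) (_hreg : IsRegular A u)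
        (k : ℝ) (_hk : 0 < k) (U : ℕ → H) (_hU : IsScheme A α k f u₀ U),
        weightedNorm c (fun n : ℕ => U n - u (n * k)) ≤
          ENNReal.ofReal (C * k) *
            (ENNReal.ofReal (Real.exp (-(c / 2))) * (∫⁻ ζ in Ioc 0 k, ‖deriv (deriv u) ζ‖ₑ)
              + ENNReal.ofReal (k / 2) * (∑' n : ℕ, thirdDerivTerm c k u (n + 2))
              + ∑' n : ℕ, memoryTerm A α c k u (n + 1)) := by
  obtain ⟨C, hC, hC₁, hC₂⟩ := exists_abs_peanoKernel_le hα0 hα1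
  have hρ1 : 0 < 1 - Real.exp (-(c / 2)) := by
    rw [sub_pos, Real.exp_lt_one_iff]; linarith
  -- The 2 comes from the energy estimate and 1/(1 - exp(-c/2)) from the geometric sum; 1 accounts
  -- for the truncation error, and 2C for the two quadrature errors Q_{n+1} and Q_n.
  refine ⟨2 / (1 - Real.exp (-(c / 2))) * (1 + 2 * C), by positivity, ?_⟩
  intro 𝕜 H _ _ _ _ _ _ A hA f hf u₀ u hu hreg k hk U hU
  set T : ℕ → H := fun n => k⁻¹ • (u ((n + 1 : ℕ) * k) - u (n * k)) - (1 / 2 : ℝ) •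
    (derivWithin u (Ici 0) ((n + 1 : ℕ) * k) + derivWithin u (Ici 0) (n * k)) with hT
  set Q : ℕ → H := fun n : ℕ => quad α k (fun m => app A (u (m * k))) n -
    conv (abelKernel α) (fun t => app A (u t)) (n * k) with hQ
  set w : ℕ → ENNReal := fun n => ENNReal.ofReal (Real.exp (-(c / 2) * n)) with hw
  set X := ENNReal.ofReal (Real.exp (-(c / 2))) * (∫⁻ ζ in Ioc 0 k, ‖deriv (deriv u) ζ‖ₑ)
  set Y := ENNReal.ofReal (k / 2) * (∑' n : ℕ, thirdDerivTerm c k u (n + 2)) with hY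
  set Z := ∑' n : ℕ, memoryTerm A α c k u (n + 1)
  have hstab := weightedNorm_le_of_norm_le_sum hc (by positivity)
    (norm_scheme_error_le hA hα0 hα1 hk hf hu hreg hU)
  have hcv := hreg.u_one.continuousOn_derivWithin (uniqueDiffOn_Ici 0) le_rfl
  have hT0 : ‖T 0‖ₑ ≤ ∫⁻ ζ in Ioc 0 k, ‖deriv (deriv u) ζ‖ₑ := by
    have := enorm_trapezoid_le_second hk (hu.continuousOn.mono Icc_subset_Ici_self)
      (hcv.mono Icc_subset_Ici_self)
      (fun t ht => hasDerivWithinAt_Ici_derivWithin hreg.u_one ht.1)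
      (fun t ht => hasDerivAt_derivWithin_deriv hreg.u_one hreg.u_two ht.1)
      (aestronglyMeasurable_deriv _ _)
    simpa [hT] using this
  have hT1 : ∀ n : ℕ, w (n + 2) * ‖T (n + 1)‖ₑ ≤
      ENNReal.ofReal (k / 2) * thirdDerivTerm c k u (n + 2) := by
    intro n
    have hpos : ∀ t ∈ Icc (((n + 1 : ℕ) : ℝ) * k) (((n + 2 : ℕ) : ℝ) * k), 0 < t := by
      intro t ht
      exact lt_of_lt_of_le (by positivity) ht.1
    have := enorm_trapezoid_le_third (a := ((n + 1 : ℕ) : ℝ) * k) (b := ((n + 2 : ℕ) : ℝ) * k)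
      (by gcongr; omega)
      (fun t ht => hasDerivAt_derivWithin_Ici hreg.u_one (hpos t ht))
      (fun t ht => hasDerivAt_derivWithin_deriv hreg.u_one hreg.u_two (hpos t ht))
      (fun t ht => ((hreg.u_three t (hpos t ht)).differentiableAt
        (Ioi_mem_nhds (hpos t ht))).hasDerivAt)
      (aestronglyMeasurable_deriv _ _)
    rw [show ((n + 2 : ℕ) : ℝ) * k - ((n + 1 : ℕ) : ℝ) * k = k by push_cast; ring] at this
    rw [thirdDerivTerm, show (((n + 2 : ℕ) : ℝ) - 1) = ((n + 1 : ℕ) : ℝ) by push_cast; ring,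
      mul_left_comm]
    gcongr
  have hQ0 : Q 0 = 0 := by
    simp only [hQ]
    rw [quad_zero, Nat.cast_zero, zero_mul, conv_abelKernel_zero, sub_zero]
  have hQ1 : ∀ n : ℕ, w (n + 1) * ‖Q (n + 1)‖ₑ ≤ ENNReal.ofReal C * memoryTerm A α c k u (n + 1) := by
    intro n
    have := enorm_quad_sub_conv_le hα0 hα1 hk hC hC₁ hC₂ hu.continuousOn_app
      (hreg.Au_one.continuousOn_derivWithin (uniqueDiffOn_Ici 0) le_rfl)
      (fun t ht => hasDerivAt_derivWithin_Ici hreg.Au_one ht)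
      (fun t ht => hasDerivAt_derivWithin_deriv hreg.Au_one hreg.Au_two ht)
      (aestronglyMeasurable_deriv _ _) (n := n + 1) (by omega)
    have a0 : 0 ≤ (((n + 1 : ℕ) : ℝ) - 1) * k := by
      rw [Nat.cast_succ, add_sub_cancel_right]; positivity
    have e1 : ∫⁻ ζ in Ioc ((((n + 1 : ℕ) : ℝ) - 1) * k) ((n + 1 : ℕ) * k),
        ‖app A (deriv (deriv u) ζ)‖ₑ =
        ∫⁻ ζ in Ioc ((((n + 1 : ℕ) : ℝ) - 1) * k) ((n + 1 : ℕ) * k),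
          ‖deriv (deriv fun t => app A (u t)) ζ‖ₑ :=
      setLIntegral_congr_fun measurableSet_Ioc fun ζ hζ => by
        rw [app_deriv_deriv hA hu.mem_domain hreg (a0.trans_lt hζ.1)]
    have e2 : ∫⁻ ζ in Ioc 0 ((((n + 1 : ℕ) : ℝ) - 1) * k),
        ENNReal.ofReal (((n + 1 : ℕ) * k - ζ) ^ (α - 1)) * ‖app A (deriv (deriv u) ζ)‖ₑ =
        ∫⁻ ζ in Ioc 0 ((((n + 1 : ℕ) : ℝ) - 1) * k),
          ENNReal.ofReal (((n + 1 : ℕ) * k - ζ) ^ (α - 1)) *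
            ‖deriv (deriv fun t => app A (u t)) ζ‖ₑ :=
      setLIntegral_congr_fun measurableSet_Ioc fun ζ hζ => by
        rw [app_deriv_deriv hA hu.mem_domain hreg hζ.1]
    rw [memoryTerm, e1, e2, (app_derivWithin hA hu.mem_domain hreg le_rfl).2, mul_left_comm]
    gcongr
  -- The average pairs Q_n with the later weight w(n+1). Monotonicity restores w(n), and the extra
  -- term n = 0 drops out because Q_0 = 0.
  have hwmono : ∀ n, w (n + 1) ≤ w n := by
    intro n
    refine ENNReal.ofReal_le_ofReal (Real.exp_le_exp.2 ?_)
    push_cast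
    nlinarith
  have sT : ∑' n : ℕ, w (n + 1) * ‖T n‖ₑ ≤ X + Y := by
    rw [tsum_eq_zero_add' ENNReal.summable]
    refine add_le_add ?_ ?_
    · simp only [hw, zero_add, Nat.cast_one, mul_one]
      exact mul_le_mul_right hT0 _
    · rw [hY, ← ENNReal.tsum_mul_left]
      exact ENNReal.tsum_le_tsum hT1
  have sQ1 : ∑' n : ℕ, w (n + 1) * ‖Q (n + 1)‖ₑ ≤ ENNReal.ofReal C * Z := by
    rw [← ENNReal.tsum_mul_left]
    exact ENNReal.tsum_le_tsum hQ1
  have sQ0 : ∑' n : ℕ, w (n + 1) * ‖Q n‖ₑ ≤ ENNReal.ofReal C * Z := by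
    refine le_trans (ENNReal.tsum_le_tsum fun n => mul_le_mul_left (hwmono n) _) ?_
    rw [tsum_eq_zero_add' ENNReal.summable, hQ0, enorm_zero, mul_zero, zero_add]
    exact sQ1
  have hr : ∀ n, ‖-T n - avg Q n‖ₑ ≤ ‖T n‖ₑ + (‖Q (n + 1)‖ₑ + ‖Q n‖ₑ) := by
    intro n
    refine (enorm_sub_le).trans ?_
    rw [enorm_neg, avg, enorm_smul]
    gcongr
    refine (mul_le_of_le_one_left zero_le ?_).trans (enorm_add_le _ _)
    rw [Real.enorm_eq_ofReal_abs, ENNReal.ofReal_le_one]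
    norm_num
  have hS : ∑' n : ℕ, w (n + 1) * ‖-T n - avg Q n‖ₑ ≤
      ENNReal.ofReal (1 + 2 * C) * (X + Y + Z) := by
    calc _ ≤ ∑' n : ℕ, (w (n + 1) * ‖T n‖ₑ + (w (n + 1) * ‖Q (n + 1)‖ₑ + w (n + 1) * ‖Q n‖ₑ)) :=
          ENNReal.tsum_le_tsum fun n => by
            rw [← mul_add, ← mul_add]; gcongr; exact hr n
      _ ≤ (X + Y) + (ENNReal.ofReal C * Z + ENNReal.ofReal C * Z) := by
          rw [ENNReal.tsum_add, ENNReal.tsum_add]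
          gcongr
      _ ≤ (X + Y + Z) + ENNReal.ofReal (2 * C) * (X + Y + Z) := by
          rw [two_mul, ENNReal.ofReal_add hC.le hC.le, add_mul]
          have hZ : Z ≤ X + Y + Z := le_add_self
          exact add_le_add le_self_add
            (add_le_add (mul_le_mul_right hZ _) (mul_le_mul_right hZ _))
      _ = _ := by
          rw [ENNReal.ofReal_add zero_le_one (by positivity), ENNReal.ofReal_one, add_mul, one_mul]
  refine hstab.trans ?_
  calc _ ≤ ENNReal.ofReal (2 * k / (1 - Real.exp (-(c / 2)))) *
        (ENNReal.ofReal (1 + 2 * C) * (X + Y + Z)) := by gcongr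
    _ = _ := by
      rw [← mul_assoc, ← ENNReal.ofReal_mul (by positivity)]
      congr 2
      ring
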